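/- Let $\hat{\mathbb C}=\mathbb C\cup\{\infty\}$ be the Riemann sphere with the spherical distance $d$. Let $\mathrm{Poly}_{\deg\ge 2}$ be the set of complex polynomials of degree at least $2$, regarded as maps $\hat{\mathbb C}\to\hat{\mathbb C}$ fixing $\infty$, with the distance $\eta(g,h)=\sup_{z\in\hat{\mathbb C}}d(g(z),h(z))$. Let $\Omega$ be the space of all non-empty compact subsets of $\mathrm{Poly}_{\deg\ge 2}$, with the topology of the Hausdorff distance. For $\Gamma\in\Omega$ let $G=\langle\Gamma\rangle$ be the semigroup generated by $\Gamma$ under composition, and put: * $F(G)$, the Fatou set: the set of $z\in\hat{\mathbb C}$ having a neighbourhood on which $G$ is normal (every sequence in $G$ has a subsequence that converges locally uniformly there with respect to $d$); $J(G)=\hat{\mathbb C}\setminus F(G)$, the Julia set; * $P(G)=\overline{\bigcup_{g\in G}CV(g)}$ (closure in $\hat{\mathbb C}$), the postcritical set, where $CV(g)$ is the set of critical values of $g:\hat{\mathbb C}\to\hat{\mathbb C}$; and $P^*(G)=P(G)\setminus\{\infty\}$. Let $$\mathcal H=\{\Gamma\in\Omega: P(\langle\Gamma\rangle)\subset F(\langle\Gamma\rangle)\},$$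 $$\mathcal B=\{\Gamma\in\Omega: P^*(\langle\Gamma\rangle)\text{ is bounded in }\mathbb C\},$$ $$\mathcal D=\{\Gamma\in\Omega: J(\langle\Gamma\rangle)\text{ is disconnected}\}$$ (the hyperbolic, the postcritically bounded, and the disconnected families). Then $\mathcal H$, $\mathcal H\cap\mathcal B$, $\mathcal H\cap\mathcal D$ and $\mathcal H\cap\mathcal B\cap\mathcal D$ are open in $\Omega$. Moreover, for every $\Gamma\in\mathcal H$ the Julia set $J(\langle\Gamma\rangle)$ is a non-empty compact subset of $\mathbb C$, and the map $\Gamma\mapsto J(\langle\Gamma\rangle)$ is continuous on $\mathcal H$ with respect to the Hausdorff topology on the space of all non-empty compact subsets of $\mathbb C$. -/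

import Mathlib

noncomputable section

open Filter Topology Polynomial
open scoped OnePoint

namespace PolySemigroup

/-! ### The Riemann sphere with the spherical distance -/

/-- The Riemann sphere `ℂ ∪ {∞}`, with the topology of the one-point compactification of `ℂ`. -/
abbrev Sphere : Type := OnePoint ℂ

/-- Inverse stereographic projection from the Riemann sphere to the unit sphere of `ℝ³`;
`∞` is sent to the north pole. -/
def stereoInv : Sphere → EuclideanSpace ℝ (Fin 3)
  | ∞ => !₂[0, 0, 1]
  | OnePoint.some z => !₂[2 * z.re / (1 + ‖z‖ ^ 2), 2 * z.im / (1 + ‖z‖ ^ 2),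
      (‖z‖ ^ 2 - 1) / (1 + ‖z‖ ^ 2)]

theorem stereoInv_infty : stereoInv ∞ = !₂[0, 0, 1] := rfl

theorem stereoInv_coe (z : ℂ) : stereoInv (z : Sphere) =
    !₂[2 * z.re / (1 + ‖z‖ ^ 2), 2 * z.im / (1 + ‖z‖ ^ 2),
      (‖z‖ ^ 2 - 1) / (1 + ‖z‖ ^ 2)] := rfl

theorem norm_stereoInv (x : Sphere) : ‖stereoInv x‖ = 1 := by
  induction x using OnePoint.rec with
  | infty => simp [stereoInv_infty, EuclideanSpace.norm_eq, Fin.sum_univ_three]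
  | coe z =>
    have h : (1 + ‖z‖ ^ 2 : ℝ) ≠ 0 := by positivity
    have hz : ‖z‖ ^ 2 = z.re ^ 2 + z.im ^ 2 := by
      rw [Complex.sq_norm, Complex.normSq_apply]; ring
    rw [stereoInv_coe, EuclideanSpace.norm_eq, Real.sqrt_eq_one]
    simp only [Fin.sum_univ_three, Real.norm_eq_abs, sq_abs]
    simp only [Matrix.cons_val_zero, Matrix.cons_val_one, Matrix.cons_val]
    rw [hz] at h ⊢
    field_simp
    ring

theorem stereoInv_ne_zero (x : Sphere) : stereoInv x ≠ 0 := by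
  intro h
  have := norm_stereoInv x
  simp [h] at this

theorem stereoInv_injective : Function.Injective stereoInv := by
  intro x y h
  induction x using OnePoint.rec with
  | infty =>
    induction y using OnePoint.rec with
    | infty => rfl
    | coe w =>
      exfalso
      have hw : (1 + ‖w‖ ^ 2 : ℝ) ≠ 0 := by positivity
      have h2 := congrArg (fun v : EuclideanSpace ℝ (Fin 3) => v 2) h
      simp [stereoInv_infty, stereoInv_coe] at h2
      rw [eq_div_iff hw] at h2
      linarith
  | coe z =>
    have hz : (1 + ‖z‖ ^ 2 : ℝ) ≠ 0 := by positivity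
    induction y using OnePoint.rec with
    | infty =>
      exfalso
      have h2 := congrArg (fun v : EuclideanSpace ℝ (Fin 3) => v 2) h
      simp [stereoInv_infty, stereoInv_coe] at h2
      rw [div_eq_iff hz] at h2
      linarith
    | coe w =>
      have hw : (1 + ‖w‖ ^ 2 : ℝ) ≠ 0 := by positivity
      have h0 := congrArg (fun v : EuclideanSpace ℝ (Fin 3) => v 0) h
      have h1 := congrArg (fun v : EuclideanSpace ℝ (Fin 3) => v 1) h
      have h2 := congrArg (fun v : EuclideanSpace ℝ (Fin 3) => v 2) h
      simp [stereoInv_coe] at h0 h1 h2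
      rw [div_eq_div_iff hz hw] at h2
      have hn : ‖z‖ ^ 2 = ‖w‖ ^ 2 := by linarith
      rw [hn] at h0 h1
      rw [div_left_inj' hw] at h0 h1
      congr 1
      apply Complex.ext <;> linarith

theorem continuous_stereoInv : Continuous stereoInv := by
  rw [OnePoint.continuous_iff]
  have key : ∀ z : ℂ, (1 + ‖z‖ ^ 2 : ℝ) ≠ 0 := fun z => by positivity
  have hN : Tendsto (fun z : ℂ => ‖z‖) (cocompact ℂ) atTop := tendsto_norm_cocompact_atTop
  have hN2 : Tendsto (fun z : ℂ => 1 + ‖z‖ ^ 2) (cocompact ℂ) atTop :=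
    tendsto_atTop_add_const_left _ _ ((tendsto_pow_atTop two_ne_zero).comp hN)
  have hI : Tendsto (fun z : ℂ => 2 / ‖z‖) (cocompact ℂ) (𝓝 0) :=
    hN.const_div_atTop 2
  have bnd : ∀ (z : ℂ) (t : ℝ), |t| ≤ ‖z‖ → ‖2 * t / (1 + ‖z‖ ^ 2)‖ ≤ 2 / ‖z‖ := by
    intro z t ht
    rcases eq_or_ne z 0 with rfl | hz
    · simp at ht; simp [ht]
    have hz' : 0 < ‖z‖ := norm_pos_iff.2 hz
    rw [Real.norm_eq_abs, abs_div, abs_mul, abs_two, abs_of_pos (show 0 < 1 + ‖z‖ ^ 2 by positivity),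
      div_le_div_iff₀ (by positivity) hz']
    nlinarith
  constructor
  · rw [coclosedCompact_eq_cocompact]
    refine (PiLp.continuous_toLp 2 (fun _ : Fin 3 => ℝ)).continuousAt.tendsto.comp
      (tendsto_pi_nhds.2 fun i => ?_)
    fin_cases i
    · exact squeeze_zero_norm (fun z => bnd z z.re (Complex.abs_re_le_norm z)) hI
    · exact squeeze_zero_norm (fun z => bnd z z.im (Complex.abs_im_le_norm z)) hI
    · have : Tendsto (fun z : ℂ => 1 - 2 / (1 + ‖z‖ ^ 2)) (cocompact ℂ) (𝓝 (1 - 0)) :=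
        tendsto_const_nhds.sub (hN2.const_div_atTop 2)
      rw [sub_zero] at this
      refine this.congr fun z => ?_
      have := key z
      simp
      field_simp
      ring
  · refine (PiLp.continuous_toLp 2 (fun _ : Fin 3 => ℝ)).comp (continuous_pi fun i => ?_)
    fin_cases i
    · exact (by fun_prop : Continuous fun z : ℂ => 2 * z.re).div (by fun_prop) key
    · exact (by fun_prop : Continuous fun z : ℂ => 2 * z.im).div (by fun_prop) key
    · exact (by fun_prop : Continuous fun z : ℂ => ‖z‖ ^ 2 - 1).div (by fun_prop) key

/-- The spherical distance: the length of the great-circle arc between the two corresponding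
points of the unit sphere of `ℝ³`. -/
def sphericalDist (x y : Sphere) : ℝ :=
  InnerProductGeometry.angle (stereoInv x) (stereoInv y)

theorem continuous_sphericalDist (x : Sphere) : Continuous fun y => sphericalDist y x := by
  unfold sphericalDist InnerProductGeometry.angle
  simp only [norm_stereoInv]
  exact Real.continuous_arccos.comp
    ((continuous_stereoInv.inner continuous_const).div_const _)

/-- A continuous bijection from a compact space to a metric space is inducing. -/
theorem isInducing_of_continuous_dist {X Y : Type} [TopologicalSpace X] [CompactSpace X]
    [MetricSpace Y] (e : X ≃ Y) (h : ∀ y, Continuous fun x => dist (e x) y) :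
    IsInducing e := by
  have hc : Continuous e := by
    rw [continuous_iff_continuousAt]
    intro x
    rw [ContinuousAt, tendsto_iff_dist_tendsto_zero]
    have := (h (e x)).tendsto x
    rwa [dist_self] at this
  exact (hc.isClosedEmbedding e.injective).isInducing

/-- The spherical distance as a metric on the set underlying the Riemann sphere. -/
abbrev sphericalMetric : MetricSpace Sphere where
  dist := sphericalDist
  dist_self x := InnerProductGeometry.angle_self (stereoInv_ne_zero x)
  dist_comm x y := InnerProductGeometry.angle_comm _ _
  dist_triangle x y z := InnerProductGeometry.angle_le_angle_add_angle _ _ _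
  eq_of_dist_eq_zero := by
    intro x y h
    apply stereoInv_injective
    obtain ⟨-, r, hr, h⟩ := InnerProductGeometry.angle_eq_zero_iff.1 h
    have h1 := norm_stereoInv y
    rw [h, norm_smul, norm_stereoInv, mul_one, Real.norm_of_nonneg hr.le] at h1
    rw [h, h1, one_smul]

theorem sphericalMetric_topology :
    (inferInstance : TopologicalSpace Sphere) =
      sphericalMetric.toUniformSpace.toTopologicalSpace := by
  obtain ⟨h⟩ := @isInducing_of_continuous_dist Sphere Sphere _ _ sphericalMetric (Equiv.refl _)
    continuous_sphericalDist
  exact h.trans (@induced_id _ sphericalMetric.toUniformSpace.toTopologicalSpace)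

/-- The Riemann sphere is a metric space under the spherical distance, which induces its usual
topology. -/
instance instMetricSpaceSphere : MetricSpace Sphere :=
  sphericalMetric.replaceTopology sphericalMetric_topology

theorem dist_eq_sphericalDist (x y : Sphere) : dist x y = sphericalDist x y := rfl

/-! ### Polynomial maps of the sphere -/

/-- The space `Poly` of non-constant complex polynomials. -/
def Poly : Type := {p : ℂ[X] // 1 ≤ p.natDegree}

/-- The self-map of the sphere given by a polynomial; it fixes `∞`. -/
def Poly.toMap (g : Poly) : Sphere → Sphere := OnePoint.map fun z => g.1.eval z

theorem Poly.continuous_toMap (g : Poly) : Continuous g.toMap := by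
  refine OnePoint.continuous_map g.1.continuous ?_
  rw [coclosedCompact_eq_cocompact, ← Metric.cobounded_eq_cocompact,
    ← tendsto_norm_atTop_iff_cobounded]
  exact g.1.tendsto_norm_atTop (natDegree_pos_iff_degree_pos.1 g.2) tendsto_norm_cobounded_atTop

/-- A polynomial as a continuous self-map of the sphere. -/
def Poly.toContinuousMap (g : Poly) : C(Sphere, Sphere) := ⟨g.toMap, g.continuous_toMap⟩

theorem Poly.toContinuousMap_injective : Function.Injective Poly.toContinuousMap := by
  intro g h e
  apply Subtype.ext
  apply Polynomial.funext
  intro z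
  have := DFunLike.congr_fun e (z : Sphere)
  exact OnePoint.coe_injective this

/-- `Poly` carries the distance `η g h = sup_z d (g z) (h z)`, the supremum over the sphere of
the spherical distance (see `Poly.dist_eq_iSup`). -/
instance : MetricSpace Poly :=
  MetricSpace.induced Poly.toContinuousMap Poly.toContinuousMap_injective inferInstance

theorem Poly.dist_eq_iSup (g h : Poly) :
    dist g h = ⨆ z : Sphere, sphericalDist (g.toMap z) (h.toMap z) :=
  ContinuousMap.dist_eq_iSup

/-- The semigroup operation on `Poly` is composition. -/
instance : Semigroup Poly where
  mul g h := ⟨g.1.comp h.1, by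
    rw [natDegree_comp]; exact Nat.mul_pos g.2 h.2⟩
  mul_assoc g h k := Subtype.ext (Polynomial.comp_assoc _ _ _)

theorem Poly.toMap_mul (g h : Poly) : (g * h).toMap = g.toMap ∘ h.toMap := by
  funext z
  induction z using OnePoint.rec with
  | infty => rfl
  | coe z => exact congrArg (fun w : ℂ => (w : Sphere)) (Polynomial.eval_comp)

/-- The space of complex polynomials of degree at least two, with the relative topology. -/
abbrev PolyDegGeTwo : Type := {g : Poly // 2 ≤ g.1.natDegree}

/-! ### Polynomial semigroups: Fatou, Julia and postcritical sets -/

/-- A family `𝓕` of self-maps of the sphere is normal on `U`: every sequence in `𝓕` has a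
subsequence that converges locally uniformly on `U` for the spherical distance. -/
def IsNormalOn (𝓕 : Set (Sphere → Sphere)) (U : Set Sphere) : Prop :=
  ∀ u : ℕ → Sphere → Sphere, (∀ n, u n ∈ 𝓕) →
    ∃ φ : ℕ → ℕ, StrictMono φ ∧ ∃ f : Sphere → Sphere,
      TendstoLocallyUniformlyOn (fun n => u (φ n)) f atTop U

/-- The Fatou set `F(G)`: the points with a neighbourhood on which `G` is normal. -/
def fatou (G : Subsemigroup Poly) : Set Sphere :=
  {z | ∃ U : Set Sphere, IsOpen U ∧ z ∈ U ∧ IsNormalOn (Poly.toMap '' (G : Set Poly)) U}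

/-- The Julia set `J(G)`. -/
def julia (G : Subsemigroup Poly) : Set Sphere := (fatou G)ᶜ

/-- The critical points of a polynomial map of the sphere: a finite point is critical iff the
derivative vanishes there; the local degree at `∞` is the degree of the polynomial, so `∞` is
critical iff the degree is at least two. -/
def criticalPoints (g : Poly) : Set Sphere :=
  {x | (x = ∞ ∧ 2 ≤ g.1.natDegree) ∨ ∃ c : ℂ, x = (c : Sphere) ∧ g.1.derivative.eval c = 0}

/-- The critical values `CV(g)` of `g` as a self-map of the sphere. -/
def criticalValues (g : Poly) : Set Sphere := g.toMap '' criticalPoints g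

/-- The postcritical set `P(G)`, the closure being taken in the sphere. -/
def postcritical (G : Subsemigroup Poly) : Set Sphere :=
  closure (⋃ g ∈ G, criticalValues g)

/-- The planar postcritical set `P*(G) = P(G) ∖ {∞}`, as a subset of `ℂ`. -/
def planarPostcritical (G : Subsemigroup Poly) : Set ℂ :=
  {z | (z : Sphere) ∈ postcritical G}

/-- `G` is hyperbolic: `P(G) ⊆ F(G)`. -/
def IsHyperbolic (G : Subsemigroup Poly) : Prop := postcritical G ⊆ fatou G

/-- The class `𝒢`: each element has degree at least two, and `G` is postcritically bounded. -/
def classG : Set (Subsemigroup Poly) :=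
  {G | (∀ g ∈ G, 2 ≤ g.1.natDegree) ∧ Bornology.IsBounded (planarPostcritical G)}

/-! ### The space `Ω` of compact families -/

/-- The space `Ω` of non-empty compact sets of polynomials of degree at least two; its topology
is that of the Hausdorff distance. -/
abbrev Omega : Type := TopologicalSpace.NonemptyCompacts PolyDegGeTwo

theorem Omega.dist_eq (Γ Γ' : Omega) :
    dist Γ Γ' = Metric.hausdorffDist (Γ : Set PolyDegGeTwo) Γ' := rfl

theorem Omega.isOpen_iff (S : Set Omega) :
    IsOpen S ↔ ∀ Γ ∈ S, ∃ ε > 0, ∀ Γ' : Omega, dist Γ' Γ < ε → Γ' ∈ S :=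
  Metric.isOpen_iff

/-- The polynomial semigroup `⟨Γ⟩` generated by `Γ`, under composition. -/
def generated (Γ : Omega) : Subsemigroup Poly :=
  Subsemigroup.closure ((fun g : PolyDegGeTwo => g.1) '' (Γ : Set PolyDegGeTwo))

/-- `Γ` such that `⟨Γ⟩` is hyperbolic. -/
def setH : Set Omega := {Γ | IsHyperbolic (generated Γ)}

/-- `Γ` such that `⟨Γ⟩` belongs to `𝒢`. -/
def setB : Set Omega := {Γ | generated Γ ∈ classG}

/-- `Γ` such that `J(⟨Γ⟩)` is disconnected. -/
def setD : Set Omega := {Γ | ¬ IsPreconnected (julia (generated Γ))}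

end PolySemigroup

end

/-!
The statement is moved to the plane. A point `z` of the plane lies in the Fatou set of `⟨Γ⟩` if and
only if the words in `Γ` are *tame* there (`Tame`): for every `R`, on some fixed disc around `z` each
word is either bounded by `2 * R` or bounded below by `R`. All polynomials of a neighbourhood of `Γ`
expand outside one disc (`Escapes`), so that `∞` always lies in the Fatou set, and hyperbolicity
says that words are tame at each point of the closure `planarPC` of the finite critical orbits.

For hyperbolic `Γ` the key fact is that no sequence of words converges to the identity on a disc
(`not_tendstoUniformlyOn_id`). The set of points near which such a convergence holds is open; it is
closed, at points of the postcritical set because words are tame there, and at other points because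
the inverse branches of the words are bounded and also converge to the identity. It would
therefore be the whole plane, which contradicts the expansion near infinity. A pigeonhole argument
on the right factors of a long word then shows that long words contract strongly where they stay
bounded on a fixed disc (`exists_norm_deriv_lt`), and expand strongly wherever their value is
bounded and away from the postcritical set (`exists_le_norm_deriv`).

Contraction near the postcritical set and expansion near infinity make the points within `δ` of the
postcritical set or of large modulus an attracting set (`attracting`), mapped well inside itself by
all long words. It also absorbs each compact set `K` of tame points, since a long word that sends a
point of `K` elsewhere would have to contract and to expand there. These properties involve only
finitely many lengths of words, hence survive small perturbations of `Γ`
(`exists_close_attracting`), and so do the bounds for the critical values. This yields at once the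
openness of hyperbolicity, the persistence of postcritical boundedness and the upper semicontinuity
of the Julia set (`eventually_hyperbolic`). Expansion gives the lower semicontinuity: an orbit that
stays in the Julia set is shadowed by an orbit of the perturbed family, and if all the points near
its origin were tame for the perturbed family, they would all have bounded orbits, against the
expansion along the first block of letters (`exists_close_not_tame`). So the Julia set depends
continuously on `Γ` for the Hausdorff distance, and a separation of it into two parts persists,
which gives the openness of the disconnected family.
-/

noncomputable section

open Filter Topology Polynomial Metric
open scoped OnePoint

namespace PolySemigroup

/-! ### Bounded holomorphic functions on discs -/

theorem norm_deriv_le_of_norm_le {f : ℂ → ℂ} {x : ℂ} {t M : ℝ} (ht : 0 < t)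
    (hf : DifferentiableOn ℂ f (ball x t)) (hM : ∀ z ∈ ball x t, ‖f z‖ ≤ M) :
    ‖deriv f x‖ ≤ 2 * M / t := by
  refine Complex.norm_deriv_le_div_of_mapsTo_ball hf (fun z hz => ?_) ht
  rw [mem_closedBall, dist_eq_norm]
  have h1 := hM z hz
  have h2 := hM x (mem_ball_self ht)
  linarith [norm_sub_le (f z) (f x)]

theorem norm_sub_le_of_norm_deriv_le {f : ℂ → ℂ} {x : ℂ} {t C : ℝ}
    (hf : DifferentiableOn ℂ f (ball x t)) (hC : ∀ z ∈ ball x t, ‖deriv f z‖ ≤ C)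
    {z w : ℂ} (hz : z ∈ ball x t) (hw : w ∈ ball x t) : ‖f z - f w‖ ≤ C * ‖z - w‖ :=
  (convex_ball x t).norm_image_sub_le_of_norm_deriv_le
    (fun _ hy => hf.differentiableAt (isOpen_ball.mem_nhds hy)) hC hw hz

theorem norm_sub_le_of_norm_le {f : ℂ → ℂ} {x : ℂ} {t M : ℝ} (ht : 0 < t)
    (hf : DifferentiableOn ℂ f (ball x t)) (hM : ∀ z ∈ ball x t, ‖f z‖ ≤ M)
    {z w : ℂ} (hz : z ∈ ball x (t / 2)) (hw : w ∈ ball x (t / 2)) :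
    ‖f z - f w‖ ≤ 4 * M / t * ‖z - w‖ := by
  refine norm_sub_le_of_norm_deriv_le (hf.mono (ball_subset_ball (by linarith)))
    (fun y hy => ?_) hz hw
  have hsub : ball y (t / 2) ⊆ ball x t := ball_subset_ball' (by
    rw [mem_ball] at hy; linarith)
  refine (norm_deriv_le_of_norm_le (half_pos ht) (hf.mono hsub)
    fun z hz => hM z (hsub hz)).trans_eq ?_
  field_simp
  ring

/-- A quantitative open mapping theorem: the image of a disc under a bounded holomorphic function
contains a disc whose radius depends only on the bound and on the derivative at the centre. -/
theorem exists_ball_subset_image {s M c : ℝ} (hs : 0 < s) (hM : 0 < M) (hc : 0 < c) :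
    ∃ t > 0, ∀ (f : ℂ → ℂ) (y : ℂ), DifferentiableOn ℂ f (ball y s) →
      (∀ z ∈ ball y s, ‖f z‖ ≤ M) → c ≤ ‖deriv f y‖ → ball (f y) t ⊆ f '' ball y s := by
  set K : ℝ := 2 * (2 * M / s) / s with hK
  have hK0 : 0 < K := by positivity
  set r : ℝ := min (s / 2) (c / (2 * K)) with hr
  have hr0 : 0 < r := by positivity
  have hrs : r < s := (min_le_left _ _).trans_lt (by linarith)
  have hrK : K * r ≤ c / 2 := by
    have : r ≤ c / (2 * K) := min_le_right _ _
    rw [le_div_iff₀ (by positivity)] at this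
    linarith
  refine ⟨c * r / 2 / 2, by positivity, fun f y hf hfM hfc => ?_⟩
  have hmap : Set.MapsTo f (ball y s) (closedBall (f y) (2 * M)) := fun z hz => by
    rw [mem_closedBall, dist_eq_norm]
    linarith [norm_sub_le (f z) (f y), hfM z hz, hfM y (mem_ball_self hs)]
  have hslope : ∀ z ∈ ball y s, ‖dslope f y z‖ ≤ 2 * M / s := fun z hz =>
    Complex.norm_dslope_le_div_of_mapsTo_ball hf hmap hz
  have hdd : DifferentiableOn ℂ (dslope f y) (ball y s) :=
    (Complex.differentiableOn_dslope (isOpen_ball.mem_nhds (mem_ball_self hs))).2 hf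
  have hnear : ∀ z ∈ ball y s, ‖dslope f y z - deriv f y‖ ≤ K * ‖z - y‖ := fun z hz => by
    have := Complex.dist_le_div_mul_dist_of_mapsTo_ball (R₂ := 2 * (2 * M / s)) hdd
      (fun w hw => by
        rw [mem_closedBall, dist_eq_norm]
        linarith [norm_sub_le (dslope f y w) (dslope f y y), hslope w hw,
          hslope y (mem_ball_self hs)]) hz
    rwa [dist_eq_norm, dist_eq_norm, dslope_same] at this
  have hsph : ∀ z ∈ sphere y r, c * r / 2 ≤ ‖f z - f y‖ := fun z hz => by
    have hzr : ‖z - y‖ = r := by rwa [mem_sphere, dist_eq_norm] at hz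
    have h1 := hnear z (by rw [mem_ball, dist_eq_norm, hzr]; exact hrs)
    have h2 : c / 2 ≤ ‖dslope f y z‖ := by
      have h3 := norm_sub_norm_le (deriv f y) (deriv f y - dslope f y z)
      rw [sub_sub_cancel, norm_sub_rev] at h3
      rw [hzr] at h1
      linarith
    have h4 : f z - f y = (z - y) * dslope f y z := by
      have := sub_smul_dslope f y z
      rw [smul_eq_mul] at this
      exact this.symm
    rw [h4, norm_mul, hzr]
    nlinarith
  have hdc : DiffContOnCl ℂ f (ball y r) :=
    (hf.mono (closedBall_subset_ball hrs)).diffContOnCl_ball subset_rfl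
  have hne : ∃ᶠ z in 𝓝 y, f z ≠ f y := by
    have hd : HasDerivAt f (deriv f y) y :=
      (hf.differentiableAt (isOpen_ball.mem_nhds (mem_ball_self hs))).hasDerivAt
    have h0 : deriv f y ≠ 0 := fun h => by rw [h, norm_zero] at hfc; linarith
    exact ((hd.eventually_ne (c := f y) h0).frequently.filter_mono nhdsWithin_le_nhds)
  exact (hdc.ball_subset_image_closedBall hr0 hsph hne).trans
    (Set.image_mono (closedBall_subset_ball hrs))

/-- A holomorphic function close to the identity on a disc covers a smaller disc. -/
theorem closedBall_subset_image_of_near_id {F : ℂ → ℂ} {y : ℂ} {r r' : ℝ} (hr : 0 < r)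
    (hrr : r < r') (hF : DifferentiableOn ℂ F (ball y r'))
    (hid : ∀ z ∈ closedBall y r, ‖F z - z‖ ≤ r / 16) :
    closedBall y (r / 4) ⊆ F '' closedBall y r := by
  have hdc : DiffContOnCl ℂ F (ball y r) :=
    (hF.mono (closedBall_subset_ball hrr)).diffContOnCl_ball subset_rfl
  have hy := hid y (mem_closedBall_self hr.le)
  have hsph : ∀ z ∈ sphere y r, 3 * r / 4 ≤ ‖F z - F y‖ := fun z hz => by
    have h1 := hid z (sphere_subset_closedBall hz)
    rw [mem_sphere, dist_eq_norm] at hz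
    have h2 : z - y = (F z - F y) - (F z - z) + (F y - y) := by ring
    have h3 := norm_add_le ((F z - F y) - (F z - z)) (F y - y)
    rw [← h2, hz] at h3
    linarith [norm_sub_le (F z - F y) (F z - z)]
  have hne : ∃ᶠ z in 𝓝 y, F z ≠ F y := by
    by_contra hcon
    rw [not_frequently] at hcon
    simp only [not_not] at hcon
    have hd : AnalyticOnNhd ℂ F (ball y r') := hF.analyticOnNhd isOpen_ball
    have heq := hd.eqOn_of_preconnected_of_eventuallyEq (analyticOnNhd_const (v := F y))
      (convex_ball y r').isPreconnected (mem_ball_self (hr.trans hrr)) hcon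
    have hmem : y + (r : ℂ) ∈ sphere y r := by simp [abs_of_pos hr]
    have h1 := hsph _ hmem
    rw [heq (closedBall_subset_ball hrr (sphere_subset_closedBall hmem)), sub_self,
      norm_zero] at h1
    linarith
  refine subset_trans (fun z hz => ?_) (hdc.ball_subset_image_closedBall hr hsph hne)
  rw [mem_closedBall] at hz
  rw [mem_ball]
  have := dist_triangle_right z (F y) y
  rw [dist_eq_norm (F y) y] at this
  linarith

/-- Montel's theorem for bounded families: a bounded sequence of holomorphic functions on a disc
has a subsequence converging uniformly on the concentric disc of half the radius. -/
theorem exists_subseq_tendstoUniformlyOn {f : ℕ → ℂ → ℂ} {q : ℂ} {s M : ℝ} (hs : 0 < s)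
    (hf : ∀ k, DifferentiableOn ℂ (f k) (ball q s)) (hM : ∀ k, ∀ z ∈ ball q s, ‖f k z‖ ≤ M) :
    ∃ φ : ℕ → ℕ, StrictMono φ ∧ ∃ g : ℂ → ℂ,
      TendstoUniformlyOn (fun k => f (φ k)) g atTop (ball q (s / 2)) := by
  have hsub : closedBall q (s / 2) ⊆ ball q s := closedBall_subset_ball (by linarith)
  have : CompactSpace (closedBall q (s / 2)) :=
    isCompact_iff_compactSpace.1 (isCompact_closedBall _ _)
  let F : ℕ → BoundedContinuousFunction (closedBall q (s / 2)) ℂ := fun k =>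
    BoundedContinuousFunction.mkOfCompact
      ⟨fun z => f k z, ((hf k).continuousOn.mono hsub).domRestrict⟩
  have hFe : ∀ k z, F k z = f k z := fun k z => rfl
  have hlip : ∀ k, ∀ z ∈ closedBall q (s / 2), ∀ w ∈ closedBall q (s / 2),
      ‖f k z - f k w‖ ≤ 8 * M / s * ‖z - w‖ := by
    intro k z hz w hw
    have hd : ∀ y ∈ closedBall q (s / 2), ‖deriv (f k) y‖ ≤ 8 * M / s := fun y hy => by
      have hsub' : ball y (s / 2) ⊆ ball q s := ball_subset_ball' (by
        rw [mem_closedBall] at hy; linarith)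
      have h1 := norm_deriv_le_of_norm_le (half_pos hs) ((hf k).mono hsub')
        fun z hz => hM k z (hsub' hz)
      have hM0 : 0 ≤ M := (norm_nonneg _).trans (hM k q (mem_ball_self hs))
      refine h1.trans ?_
      rw [div_le_div_iff₀ (half_pos hs) hs]
      nlinarith [mul_nonneg hM0 hs.le]
    exact (convex_closedBall q (s / 2)).norm_image_sub_le_of_norm_deriv_le
      (fun y hy => (hf k).differentiableAt (isOpen_ball.mem_nhds (hsub hy))) hd hw hz
  have hcomp : IsCompact (closure (Set.range F)) := by
    refine BoundedContinuousFunction.arzela_ascoli (closedBall (0 : ℂ) M)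
      (isCompact_closedBall _ _) _ ?_ ?_
    · rintro _ x ⟨k, rfl⟩
      rw [mem_closedBall_zero_iff]
      exact hM k _ (hsub x.2)
    · refine Metric.equicontinuous_of_continuity_modulus (fun d => 8 * M / s * d) ?_ _ ?_
      · have : Tendsto (fun d : ℝ => 8 * M / s * d) (𝓝 0) (𝓝 (8 * M / s * 0)) :=
          tendsto_const_nhds.mul tendsto_id
        simpa using this
      · rintro x y ⟨_, k, rfl⟩
        rw [Subtype.dist_eq, dist_eq_norm, dist_eq_norm]
        exact hlip k x x.2 y y.2
  obtain ⟨g, -, φ, hφ, hg⟩ := hcomp.tendsto_subseq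
    (fun k => subset_closure (Set.mem_range_self (f := F) k))
  classical
  refine ⟨φ, hφ, fun z => if h : z ∈ closedBall q (s / 2) then g ⟨z, h⟩ else 0, ?_⟩
  rw [BoundedContinuousFunction.tendsto_iff_tendstoUniformly,
    Metric.tendstoUniformly_iff] at hg
  rw [Metric.tendstoUniformlyOn_iff]
  intro ε hε
  filter_upwards [hg ε hε] with k hk z hz
  have hz' := ball_subset_closedBall hz
  have := hk ⟨z, hz'⟩
  simp only [dif_pos hz']
  exact this

/-- Vitali's theorem for null sequences: convergence to zero of bounded holomorphic functions
propagates from a small disc. -/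
theorem tendstoUniformlyOn_zero_of_small_ball {e : ℕ → ℂ → ℂ} {q q' : ℂ} {s s' M : ℝ}
    (hs : 0 < s) (hs' : 0 < s')
    (he : ∀ᶠ k in atTop, DifferentiableOn ℂ (e k) (ball q s) ∧ ∀ z ∈ ball q s, ‖e k z‖ ≤ M)
    (hsub : ball q' s' ⊆ ball q (s / 2))
    (h0 : TendstoUniformlyOn e 0 atTop (ball q' s')) :
    TendstoUniformlyOn e 0 atTop (ball q (s / 2)) := by
  by_contra hcon
  rw [Metric.tendstoUniformlyOn_iff] at hcon
  push Not at hcon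
  obtain ⟨ε, hε, hfr⟩ := hcon
  obtain ⟨φ, hφ, hφ'⟩ := extraction_of_frequently_atTop (hfr.and_eventually he)
  obtain ⟨ψ, hψ, g, hg⟩ := exists_subseq_tendstoUniformlyOn hs (fun k => (hφ' k).2.1)
    (fun k => (hφ' k).2.2)
  have hgd : DifferentiableOn ℂ g (ball q (s / 2)) :=
    hg.tendstoLocallyUniformlyOn.differentiableOn
      (Eventually.of_forall fun k => (hφ' _).2.1.mono (ball_subset_ball (by linarith))) isOpen_ball
  have hg0 : ∀ z ∈ ball q' s', g z = 0 := fun z hz => by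
    have h1 := hg.tendsto_at (hsub hz)
    have h2 : Tendsto (fun k => e (φ (ψ k)) z) atTop (𝓝 0) :=
      (h0.tendsto_at hz).comp ((hφ.comp hψ).tendsto_atTop)
    exact tendsto_nhds_unique h1 h2
  have hgz : Set.EqOn g 0 (ball q (s / 2)) :=
    (hgd.analyticOnNhd isOpen_ball).eqOn_zero_of_preconnected_of_eventuallyEq_zero
      (convex_ball _ _).isPreconnected (hsub (mem_ball_self hs'))
      (by filter_upwards [isOpen_ball.mem_nhds (mem_ball_self hs')] with z hz using hg0 z hz)
  obtain ⟨k, hk⟩ := ((Metric.tendstoUniformlyOn_iff.1 hg ε hε)).exists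
  obtain ⟨z, hz, hz'⟩ := (hφ' (ψ k)).1
  have := hk z hz
  rw [hgz hz] at this
  exact absurd this (not_lt.2 hz')

/-- Total boundedness of the space of bounded holomorphic functions on a disc, as a pigeonhole
principle. -/
theorem exists_pair_close {t M ε : ℝ} (ht : 0 < t) (hM : 0 < M) (hε : 0 < ε) :
    ∃ N : ℕ, ∀ (f : ℕ → ℂ → ℂ) (x : ℂ),
      (∀ k ≤ N, DifferentiableOn ℂ (f k) (ball x t) ∧ ∀ z ∈ ball x t, ‖f k z‖ ≤ M) →
      ∃ i j, i < j ∧ j ≤ N ∧ ∀ z ∈ ball x (t / 2), ‖f i z - f j z‖ ≤ ε := by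
  have hρ : 0 < ε / 4 / (4 * M / t) := by positivity
  obtain ⟨A, hAs, hAf, hA⟩ := Metric.finite_approx_of_totallyBounded
    ((isCompact_closedBall (0 : ℂ) (t / 2)).totallyBounded.subset ball_subset_closedBall) _ hρ
  obtain ⟨B, -, hBf, hB⟩ := Metric.finite_approx_of_totallyBounded
    (isCompact_closedBall (0 : ℂ) M).totallyBounded (ε / 4) (by positivity)
  have := hAf.fintype
  have := hBf.fintype
  classical
  refine ⟨Fintype.card (A → B), fun f x hf => ?_⟩
  have hx : ∀ z : ℂ, z ∈ ball (0 : ℂ) (t / 2) → x + z ∈ ball x (t / 2) := fun z hz => by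
    rw [mem_ball_zero_iff] at hz
    simpa [mem_ball, dist_eq_norm] using hz
  have hbig : ball x (t / 2) ⊆ ball x t := ball_subset_ball (by linarith)
  have hch : ∀ k : Fin (Fintype.card (A → B) + 1), ∃ g : A → B,
      ∀ a : A, dist (f k (x + a)) (g a) < ε / 4 := by
    intro k
    have : ∀ a : A, ∃ b : B, dist (f k (x + a)) b < ε / 4 := fun a => by
      have h1 : f k (x + a) ∈ closedBall (0 : ℂ) M := by
        rw [mem_closedBall_zero_iff]
        exact (hf k (Nat.lt_succ_iff.1 k.2)).2 _ (hbig (hx _ (hAs a.2)))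
      have h2 := hB h1
      simp only [Set.mem_iUnion] at h2
      obtain ⟨b, hb, h3⟩ := h2
      exact ⟨⟨b, hb⟩, h3⟩
    choose g hg using this
    exact ⟨g, hg⟩
  choose g hg using hch
  obtain ⟨i, j, hij, hgij⟩ := Fintype.exists_ne_map_eq_of_card_lt g (by simp)
  have key : ∀ z ∈ ball x (t / 2), ‖f i z - f j z‖ ≤ ε := by
    intro z hz
    have h1 : z - x ∈ ball (0 : ℂ) (t / 2) := by
      rw [mem_ball_zero_iff]; rwa [mem_ball, dist_eq_norm] at hz
    have h2 := hA h1
    simp only [Set.mem_iUnion] at h2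
    obtain ⟨a, ha, h3⟩ := h2
    have hlip : ∀ k : Fin (Fintype.card (A → B) + 1), ‖f k z - f k (x + a)‖ ≤ ε / 4 := fun k => by
      have h4 := norm_sub_le_of_norm_le ht (hf k (Nat.lt_succ_iff.1 k.2)).1
        (hf k (Nat.lt_succ_iff.1 k.2)).2 hz (hx _ (hAs ha))
      refine h4.trans ?_
      rw [mem_ball, dist_eq_norm] at h3
      have h5 : z - (x + a) = z - x - a := by ring
      rw [h5]
      have := mul_le_mul_of_nonneg_left h3.le (show 0 ≤ 4 * M / t by positivity)
      refine this.trans_eq ?_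
      field_simp
    have h6 := hg i ⟨a, ha⟩
    have h7 := hg j ⟨a, ha⟩
    rw [hgij] at h6
    rw [dist_eq_norm] at h6 h7
    have h8 : f i z - f j z = (f i z - f i (x + a)) + (f i (x + a) - g j ⟨a, ha⟩)
      - (f j (x + a) - g j ⟨a, ha⟩) - (f j z - f j (x + a)) := by ring
    rw [h8]
    refine (norm_sub_le _ _).trans ?_
    have h9 := norm_sub_le ((f i z - f i (x + a)) + (f i (x + a) - g j ⟨a, ha⟩))
      (f j (x + a) - g j ⟨a, ha⟩)
    have h10 := norm_add_le (f i z - f i (x + a)) (f i (x + a) - g j ⟨a, ha⟩)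
    linarith [hlip i, hlip j]
  rcases lt_or_gt_of_ne (fun h => hij (Fin.ext h) : (i : ℕ) ≠ j) with h | h
  · exact ⟨i, j, h, Nat.lt_succ_iff.1 j.2, key⟩
  · exact ⟨j, i, h, Nat.lt_succ_iff.1 i.2, fun z hz => by rw [norm_sub_rev]; exact key z hz⟩

/-- Inverse branches of a polynomial exist on discs without critical values. -/
theorem exists_inverse_branch (p : ℂ[X]) {y x : ℂ} {s : ℝ} (hs : 0 < s)
    (hcrit : ∀ c, p.derivative.eval c = 0 → p.eval c ∉ ball y s) {y' : ℂ}
    (hy' : y' ∈ ball y s) (hx : p.eval x = y') :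
    ∃ h : ℂ → ℂ, DifferentiableOn ℂ h (ball y s) ∧ (∀ z ∈ ball y s, p.eval (h z) = z) ∧
      h y' = x := by
  classical
  have : LocallyPathConnectedSpace (ball y s) := isOpen_ball.locallyPathConnectedSpace
  have : ContractibleSpace (ball y s) :=
    (convex_ball y s).contractibleSpace ⟨y, mem_ball_self hs⟩
  obtain ⟨F, ⟨hF0, hF⟩, -⟩ := p.isCoveringMapOn_eval.existsUnique_continuousMap_lifts
    (⟨Subtype.val, continuous_subtype_val⟩ : C(ball y s, ℂ)) (a₀ := ⟨y', hy'⟩) (e₀ := x) hx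
    (by
      rintro ⟨a, ha⟩ ⟨c, hc, hca⟩
      exact hcrit c hc (by rw [show p.eval c = a from hca]; exact ha))
  refine ⟨fun z => if hz : z ∈ ball y s then F ⟨z, hz⟩ else 0, ?_, ?_, ?_⟩
  · intro z hz
    have hFz : ∀ w (hw : w ∈ ball y s), p.eval (F ⟨w, hw⟩) = w := fun w hw => congrFun hF ⟨w, hw⟩
    have hne : p.derivative.eval (F ⟨z, hz⟩) ≠ 0 := fun h0 =>
      hcrit _ h0 (by rw [hFz]; exact hz)
    refine DifferentiableAt.differentiableWithinAt ?_
    have hcont : ContinuousAt (fun w => if hw : w ∈ ball y s then F ⟨w, hw⟩ else 0) z := by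
      have : ContinuousOn (fun w => if hw : w ∈ ball y s then F ⟨w, hw⟩ else 0) (ball y s) := by
        rw [continuousOn_iff_continuous_domRestrict]
        convert F.continuous using 1
        ext ⟨w, hw⟩
        simp only [Set.domRestrict_apply, dif_pos hw]
      exact this.continuousAt (isOpen_ball.mem_nhds hz)
    refine (HasDerivAt.of_local_left_inverse (f := fun w => p.eval w) hcont
      (f' := p.derivative.eval (F ⟨z, hz⟩)) ?_ hne ?_).differentiableAt
    · simp only [dif_pos hz]
      exact p.hasDerivAt _
    · filter_upwards [isOpen_ball.mem_nhds hz] with w hw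
      simp only [dif_pos hw]
      exact hFz w hw
  · intro z hz
    simp only [dif_pos hz]
    exact congrFun hF ⟨z, hz⟩
  · simp only [dif_pos hy']
    exact hF0

/-! ### Words of polynomials in the plane -/

/-- The composition of a list of polynomials; the head of the list is applied last, and the empty
list gives the identity. -/
def comps (l : List ℂ[X]) : ℂ[X] := l.foldr Polynomial.comp X

/-- The self-map of the plane given by a word of polynomials, the head being applied last. -/
def wd (l : List ℂ[X]) (z : ℂ) : ℂ := (comps l).eval z

@[simp] theorem wd_nil (z : ℂ) : wd [] z = z := by simp [wd, comps]

@[simp] theorem wd_cons (p : ℂ[X]) (l : List ℂ[X]) (z : ℂ) : wd (p :: l) z = p.eval (wd l z) := by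
  simp [wd, comps]

theorem wd_append (l₁ l₂ : List ℂ[X]) (z : ℂ) : wd (l₁ ++ l₂) z = wd l₁ (wd l₂ z) := by
  induction l₁ with
  | nil => simp
  | cons p l ih => simp [ih]

theorem differentiable_wd (l : List ℂ[X]) : Differentiable ℂ (wd l) := (comps l).differentiable

theorem deriv_wd (l : List ℂ[X]) (z : ℂ) : deriv (wd l) z = (comps l).derivative.eval z :=
  (comps l).deriv

theorem deriv_wd_append (l₁ l₂ : List ℂ[X]) (z : ℂ) :
    deriv (wd (l₁ ++ l₂)) z = deriv (wd l₁) (wd l₂ z) * deriv (wd l₂) z := by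
  rw [show wd (l₁ ++ l₂) = wd l₁ ∘ wd l₂ from funext (wd_append l₁ l₂)]
  exact deriv_comp z (differentiable_wd l₁ _) (differentiable_wd l₂ _)

/-- The points of the plane on the forward orbits of the finite critical values of `S`. -/
def critOrbit (S : Set ℂ[X]) : Set ℂ :=
  {z | ∃ l : List ℂ[X], (∀ p ∈ l, p ∈ S) ∧ ∃ p ∈ S, ∃ c, p.derivative.eval c = 0 ∧
    z = wd l (p.eval c)}

/-- The planar postcritical set of the semigroup generated by `S`. -/
def planarPC (S : Set ℂ[X]) : Set ℂ := closure (critOrbit S)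

theorem wd_mem_critOrbit {S : Set ℂ[X]} {l : List ℂ[X]} (hl : ∀ p ∈ l, p ∈ S) {z : ℂ}
    (hz : z ∈ critOrbit S) : wd l z ∈ critOrbit S := by
  obtain ⟨l', hl', p, hp, c, hc, rfl⟩ := hz
  refine ⟨l ++ l', fun q hq => ?_, p, hp, c, hc, (wd_append _ _ _).symm⟩
  rcases List.mem_append.1 hq with h | h
  exacts [hl q h, hl' q h]

theorem wd_mem_planarPC {S : Set ℂ[X]} {l : List ℂ[X]} (hl : ∀ p ∈ l, p ∈ S) {z : ℂ}
    (hz : z ∈ planarPC S) : wd l z ∈ planarPC S :=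
  map_mem_closure (differentiable_wd l).continuous hz fun _ => wd_mem_critOrbit hl

/-- The critical values of a word are on the orbits of the critical values of its letters, by the
chain rule. -/
theorem wd_mem_critOrbit_of_deriv_eq_zero {S : Set ℂ[X]} {l : List ℂ[X]} (hl : ∀ p ∈ l, p ∈ S)
    {c : ℂ} (hc : (comps l).derivative.eval c = 0) : wd l c ∈ critOrbit S := by
  induction l with
  | nil => simp [comps] at hc
  | cons p l ih =>
    have hl' : ∀ q ∈ l, q ∈ S := fun q hq => hl q (List.mem_cons_of_mem _ hq)
    have hp : p ∈ S := hl p List.mem_cons_self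
    have hc' : (comps l).derivative.eval c * p.derivative.eval (wd l c) = 0 := by
      have : comps (p :: l) = p.comp (comps l) := rfl
      rw [this, derivative_comp, eval_mul, eval_comp] at hc
      exact hc
    rcases mul_eq_zero.1 hc' with h | h
    · have := wd_mem_critOrbit (l := [p]) (by simpa using hp) (ih hl' h)
      simpa using this
    · exact ⟨[], by simp, p, hp, wd l c, h, by simp⟩

/-- `S` expands outside the disc of radius `R`. -/
structure Escapes (R : ℝ) (S : Set ℂ[X]) : Prop where
  one_le : 1 ≤ R
  two_mul_le : ∀ p ∈ S, ∀ z : ℂ, R ≤ ‖z‖ → 2 * ‖z‖ ≤ ‖p.eval z‖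

theorem Escapes.pow_mul_le {R : ℝ} {S : Set ℂ[X]} (hE : Escapes R S) {l : List ℂ[X]}
    (hl : ∀ p ∈ l, p ∈ S) {z : ℂ} (hz : R ≤ ‖z‖) : 2 ^ l.length * ‖z‖ ≤ ‖wd l z‖ := by
  induction l with
  | nil => simp
  | cons p l ih =>
    have h1 := ih fun q hq => hl q (List.mem_cons_of_mem _ hq)
    have h2 : (1 : ℝ) ≤ 2 ^ l.length := one_le_pow₀ (by norm_num)
    have h3 : R ≤ ‖wd l z‖ := by nlinarith [norm_nonneg z]
    have h4 := hE.two_mul_le p (hl p List.mem_cons_self) _ h3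
    rw [wd_cons, List.length_cons, pow_succ]
    linarith

theorem Escapes.le_norm_wd {R : ℝ} {S : Set ℂ[X]} (hE : Escapes R S) {l : List ℂ[X]}
    (hl : ∀ p ∈ l, p ∈ S) {z : ℂ} (hz : R ≤ ‖z‖) : ‖z‖ ≤ ‖wd l z‖ := by
  have h1 := hE.pow_mul_le hl hz
  have h2 : (1 : ℝ) ≤ 2 ^ l.length := one_le_pow₀ (by norm_num)
  nlinarith [norm_nonneg z]

theorem Escapes.norm_le_of_norm_wd_le {R M : ℝ} {S : Set ℂ[X]} (hE : Escapes R S) (hRM : R ≤ M)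
    {l : List ℂ[X]} (hl : ∀ p ∈ l, p ∈ S) {z : ℂ} (hz : ‖wd l z‖ ≤ M) : ‖z‖ ≤ M := by
  by_contra! h
  linarith [hE.le_norm_wd hl (hRM.trans h.le)]

/-- On some disc around `z` each word of `S` is either bounded by `2 * R` or bounded below
by `R`. -/
def TameAt (S : Set ℂ[X]) (R : ℝ) (z : ℂ) : Prop :=
  ∃ s > 0, ∀ l : List ℂ[X], (∀ p ∈ l, p ∈ S) →
    (∀ w ∈ ball z s, ‖wd l w‖ ≤ 2 * R) ∨ (∀ w ∈ ball z s, R ≤ ‖wd l w‖)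

/-- The planar form of belonging to the Fatou set: near `z` no word takes both small and large
values, at any scale. -/
def Tame (S : Set ℂ[X]) (z : ℂ) : Prop := ∀ R > 0, TameAt S R z

theorem exists_uniform_tame {S : Set ℂ[X]} {R : ℝ} {K : Set ℂ} (hK : IsCompact K)
    (h : ∀ z ∈ K, TameAt S R z) :
    ∃ s > 0, ∀ z ∈ K, ∀ l : List ℂ[X], (∀ p ∈ l, p ∈ S) →
      (∀ w ∈ ball z s, ‖wd l w‖ ≤ 2 * R) ∨ (∀ w ∈ ball z s, R ≤ ‖wd l w‖) := by
  choose! s hs hd using h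
  obtain ⟨δ, hδ, hδ'⟩ := lebesgue_number_lemma_of_metric (ι := K) hK
    (c := fun i => ball i.1 (s i)) (fun _ => isOpen_ball)
    (fun z hz => Set.mem_iUnion.2 ⟨⟨z, hz⟩, mem_ball_self (hs z hz)⟩)
  refine ⟨δ, hδ, fun z hz l hl => ?_⟩
  obtain ⟨⟨i, hi⟩, hsub⟩ := hδ' z hz
  rcases hd i hi l hl with h | h
  · exact Or.inl fun w hw => h w (hsub hw)
  · exact Or.inr fun w hw => h w (hsub hw)

/-- Words have inverse branches on discs that miss the postcritical set, and these are bounded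
because words do not decrease large moduli. -/
theorem exists_inverse_branch_wd {R M : ℝ} {S : Set ℂ[X]} (hE : Escapes R S) (hRM : R ≤ M)
    {l : List ℂ[X]} (hl : ∀ p ∈ l, p ∈ S) {y x : ℂ} {s : ℝ} (hs : 0 < s)
    (hd : Disjoint (ball y s) (planarPC S)) (hM : ‖y‖ + s ≤ M) (hx : wd l x ∈ ball y s) :
    ∃ h : ℂ → ℂ, DifferentiableOn ℂ h (ball y s) ∧ (∀ z ∈ ball y s, wd l (h z) = z) ∧
      h (wd l x) = x ∧ ∀ z ∈ ball y s, ‖h z‖ ≤ M := by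
  obtain ⟨h, h1, h2, h3⟩ := exists_inverse_branch (comps l) hs
    (fun c hc hmem => Set.disjoint_left.1 hd hmem
      (subset_closure (wd_mem_critOrbit_of_deriv_eq_zero hl hc))) hx rfl
  refine ⟨h, h1, h2, h3, fun z hz => hE.norm_le_of_norm_wd_le hRM hl ?_⟩
  have h4 : wd l (h z) = z := h2 z hz
  rw [h4]
  rw [mem_ball, dist_eq_norm] at hz
  linarith [norm_le_norm_add_norm_sub' z y]

theorem deriv_inverse_branch_mul {l : List ℂ[X]} {h : ℂ → ℂ} {y : ℂ} {s : ℝ}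
    (hd : DifferentiableOn ℂ h (ball y s)) (hi : ∀ z ∈ ball y s, wd l (h z) = z) {z : ℂ}
    (hz : z ∈ ball y s) : deriv (wd l) (h z) * deriv h z = 1 := by
  have hdz := hd.differentiableAt (isOpen_ball.mem_nhds hz)
  rw [← deriv_comp z (differentiable_wd l _) hdz]
  have : wd l ∘ h =ᶠ[𝓝 z] id := by
    filter_upwards [isOpen_ball.mem_nhds hz] with w hw using hi w hw
  rw [this.deriv_eq, deriv_id]

/-- An inverse branch fixed at one point of a connected set is a left inverse there. -/
theorem inverse_branch_comp_eq {l : List ℂ[X]} {h : ℂ → ℂ} {y q : ℂ} {s r : ℝ}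
    (hd : DifferentiableOn ℂ h (ball y s)) (hi : ∀ z ∈ ball y s, wd l (h z) = z) (hr : 0 < r)
    (hmaps : ∀ z ∈ ball q r, wd l z ∈ ball y s) (hq : h (wd l q) = q) :
    ∀ z ∈ ball q r, h (wd l z) = z := by
  have hqr := mem_ball_self (x := q) hr
  have hne : deriv (wd l) q ≠ 0 := by
    have := deriv_inverse_branch_mul hd hi (hmaps q hqr)
    rw [hq] at this
    exact left_ne_zero_of_mul_eq_one this
  have hcomp : DifferentiableOn ℂ (fun z => h (wd l z)) (ball q r) :=
    hd.comp (differentiable_wd l).differentiableOn hmaps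
  have hstrict : HasStrictDerivAt (wd l) (deriv (wd l) q) q := by
    rw [deriv_wd]; exact (comps l).hasStrictDerivAt q
  set e := (hstrict.hasStrictFDerivAt_equiv hne).toOpenPartialHomeomorph with he
  have hsrc : e.source ∈ 𝓝 q := e.open_source.mem_nhds
    (hstrict.hasStrictFDerivAt_equiv hne).mem_toOpenPartialHomeomorph_source
  have hinj : Set.InjOn (wd l) e.source := e.injOn
  have hcont : ContinuousAt (fun z => h (wd l z)) q :=
    (hcomp.differentiableAt (isOpen_ball.mem_nhds hqr)).continuousAt
  have hev : ∀ᶠ z in 𝓝 q, h (wd l z) = z := by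
    have h1 : ∀ᶠ z in 𝓝 q, h (wd l z) ∈ e.source := hcont (by
      simp only [hq]; exact hsrc)
    filter_upwards [h1, hsrc, isOpen_ball.mem_nhds hqr] with z hz1 hz2 hz3
    exact hinj hz1 hz2 (hi _ (hmaps z hz3))
  exact (hcomp.analyticOnNhd isOpen_ball).eqOn_of_preconnected_of_eventuallyEq
    (analyticOnNhd_id) (convex_ball q r).isPreconnected hqr hev

/-! ### The identity is not a limit of words -/

/-- In a hyperbolic semigroup no sequence of words converges to the identity on a disc: the set of
points near which the convergence holds would be open and closed, hence would reach the
neighbourhood of infinity, where words expand. -/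
theorem not_tendstoUniformlyOn_id {R : ℝ} {S : Set ℂ[X]} (hE : Escapes R S)
    (hH : ∀ z ∈ planarPC S, Tame S z) {v : ℕ → List ℂ[X]} (hv : ∀ m, ∀ p ∈ v m, p ∈ S)
    (hv0 : ∀ m, v m ≠ []) {q₀ : ℂ} {s₀ : ℝ} (hs₀ : 0 < s₀) :
    ¬ TendstoUniformlyOn (fun m z => wd (v m) z - z) 0 atTop (ball q₀ s₀) := by
  intro h0
  set U : Set ℂ := {z | ∃ s > 0, TendstoUniformlyOn (fun m z => wd (v m) z - z) 0 atTop (ball z s)}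
    with hU
  have hopen : IsOpen U := by
    rw [Metric.isOpen_iff]
    rintro z ⟨s, hs, hz⟩
    refine ⟨s, hs, fun w hw => ⟨s - dist w z, by rw [mem_ball] at hw; linarith, hz.mono ?_⟩⟩
    exact ball_subset_ball' (by linarith)
  have hlim : ∀ z ∈ U, Tendsto (fun m => wd (v m) z - z) atTop (𝓝 0) := by
    rintro z ⟨s, hs, hz⟩
    exact hz.tendsto_at (mem_ball_self hs)
  have hclosed : IsClosed U := by
    refine isClosed_of_closure_subset fun q hq => ?_
    rw [Metric.mem_closure_iff] at hq
    -- at postcritical points the words themselves are bounded near `q`, by tameness; elsewhere their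
    -- inverse branches are, and convergence of these to the identity transfers back to the words
    by_cases hqP : q ∈ planarPC S
    · obtain ⟨s, hs, hsd⟩ := hH q hqP (‖q‖ + s₀ + 2) (by positivity)
      obtain ⟨q', hq'U, hqq'⟩ := hq (min (s / 4) 1) (by positivity)
      have hq's : dist q q' < s / 4 := hqq'.trans_le (min_le_left _ _)
      have hq'1 : dist q q' < 1 := hqq'.trans_le (min_le_right _ _)
      have hlim' := hlim q' hq'U
      obtain ⟨s', hs', hconv⟩ := hq'U
      refine ⟨s / 2, by positivity, ?_⟩
      refine tendstoUniformlyOn_zero_of_small_ball (q' := q') (s' := min s' (s / 4))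
        (M := 2 * (‖q‖ + s₀ + 2) + (‖q‖ + s)) hs (by positivity) ?_ ?_
        (hconv.mono (ball_subset_ball (min_le_left _ _)))
      · have hsmall : ∀ᶠ m in atTop, ‖wd (v m) q' - q'‖ < 1 := by
          have := hlim'.norm
          rw [norm_zero] at this
          exact this.eventually_lt_const one_pos
        filter_upwards [hsmall] with m hm
        refine ⟨((differentiable_wd _).sub differentiable_id).differentiableOn, fun z hz => ?_⟩
        have hnq : ‖q' - q‖ < 1 := by rwa [← dist_eq_norm, dist_comm]
        have h1 : ∀ w ∈ ball q s, ‖wd (v m) w‖ ≤ 2 * (‖q‖ + s₀ + 2) := by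
          refine (hsd (v m) (hv m)).resolve_right fun h => ?_
          have h2 := h q' (by rw [mem_ball, dist_comm]; linarith)
          have h3 := norm_le_norm_add_norm_sub' (wd (v m) q') q'
          have h4 := norm_le_norm_add_norm_sub' q' q
          linarith
        have h5 := norm_sub_le (wd (v m) z) z
        have h6 := norm_le_norm_add_norm_sub' z q
        rw [mem_ball, dist_eq_norm] at hz
        linarith [h1 z (by rwa [mem_ball, dist_eq_norm])]
      · refine ball_subset_ball' ?_
        have := min_le_right s' (s / 4)
        rw [dist_comm] at hq's
        linarith
    · obtain ⟨r, hr, hrP⟩ := Metric.isOpen_iff.1 (isClosed_closure (s := critOrbit S)).isOpen_compl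
        q hqP
      have hdisj : Disjoint (ball q r) (planarPC S) := Set.disjoint_left.2 fun z hz => hrP hz
      obtain ⟨q', hq'U, hqq'⟩ := hq (r / 8) (by positivity)
      obtain ⟨s₁, hs₁, hconv₁⟩ := hq'U
      set s' := min s₁ (r / 8) with hs'def
      have hs' : 0 < s' := by positivity
      have hs'r : s' ≤ r / 8 := min_le_right _ _
      have hconv := hconv₁.mono (ball_subset_ball (min_le_left s₁ (r / 8)))
      have hsub : ∀ z ∈ ball q' s', z ∈ ball q (r / 4) := fun z hz => by
        rw [mem_ball] at hz ⊢
        have := dist_triangle z q' q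
        rw [dist_comm q' q] at this
        linarith
      set M := max R (‖q‖ + r) with hM
      have hgood : ∀ᶠ m in atTop, ∀ z ∈ ball q' s', ‖wd (v m) z - z‖ < s' / 2 / 16 := by
        have := Metric.tendstoUniformlyOn_iff.1 hconv (s' / 2 / 16) (by positivity)
        simpa only [Pi.zero_apply, dist_zero_left] using this
      have hmaps : ∀ m, (∀ z ∈ ball q' s', ‖wd (v m) z - z‖ < s' / 2 / 16) →
          ∀ z ∈ ball q' s', wd (v m) z ∈ ball q r := fun m hm z hz => by
        have h1 := hm z hz
        have h2 := hsub z hz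
        rw [mem_ball, dist_eq_norm] at h2 ⊢
        have h3 : wd (v m) z - q = (wd (v m) z - z) + (z - q) := by ring
        rw [h3]
        linarith [norm_add_le (wd (v m) z - z) (z - q)]
      have hex : ∀ m, ∃ h : ℂ → ℂ, (∀ z ∈ ball q' s', ‖wd (v m) z - z‖ < s' / 2 / 16) →
          DifferentiableOn ℂ h (ball q r) ∧ (∀ z ∈ ball q r, wd (v m) (h z) = z) ∧
          (∀ z ∈ ball q r, ‖h z‖ ≤ M) ∧ (∀ z ∈ ball q' s', h (wd (v m) z) = z) := by
        intro m
        by_cases hm : ∀ z ∈ ball q' s', ‖wd (v m) z - z‖ < s' / 2 / 16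
        · obtain ⟨h, h1, h2, h3, h4⟩ := exists_inverse_branch_wd hE (le_max_left R (‖q‖ + r))
            (hv m) hr hdisj (le_max_right _ _) (hmaps m hm q' (mem_ball_self hs'))
          exact ⟨h, fun _ => ⟨h1, h2, h4, inverse_branch_comp_eq h1 h2 hs' (hmaps m hm) h3⟩⟩
        · exact ⟨0, fun h => absurd h hm⟩
      choose h hh using hex
      have hsurj : ∀ m, (∀ z ∈ ball q' s', ‖wd (v m) z - z‖ < s' / 2 / 16) →
          ∀ ζ ∈ ball q' (s' / 8), ∃ z ∈ ball q' s', wd (v m) z = ζ := by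
        intro m hm ζ hζ
        obtain ⟨z, hz, hz'⟩ := closedBall_subset_image_of_near_id (F := wd (v m)) (y := q')
          (half_pos hs') (half_lt_self hs') (differentiable_wd _).differentiableOn
          (fun z hz => (hm z (closedBall_subset_ball (half_lt_self hs') hz)).le)
          (ball_subset_closedBall (by convert hζ using 2; ring))
        exact ⟨z, closedBall_subset_ball (half_lt_self hs') hz, hz'⟩
      have hh0 : TendstoUniformlyOn (fun m z => h m z - z) 0 atTop (ball q' (s' / 8)) := by
        rw [Metric.tendstoUniformlyOn_iff] at hconv ⊢
        intro ε hε
        filter_upwards [hconv ε hε, hgood] with m hm1 hm2 ζ hζ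
        obtain ⟨z, hz, rfl⟩ := hsurj m hm2 ζ hζ
        rw [(hh m hm2).2.2.2 z hz]
        have := hm1 z hz
        simp only [Pi.zero_apply, dist_zero_left] at this ⊢
        rwa [norm_sub_rev]
      have hh1 : TendstoUniformlyOn (fun m z => h m z - z) 0 atTop (ball q (r / 2)) := by
        refine tendstoUniformlyOn_zero_of_small_ball (q' := q') (s' := s' / 8)
          (M := M + (‖q‖ + r)) hr (by positivity) ?_ ?_ hh0
        · filter_upwards [hgood] with m hm
          refine ⟨(hh m hm).1.sub differentiableOn_id, fun z hz => ?_⟩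
          have h1 := (hh m hm).2.2.1 z hz
          have h6 := norm_le_norm_add_norm_sub' z q
          rw [mem_ball, dist_eq_norm] at hz
          linarith [norm_sub_le (h m z) z]
        · intro z hz
          exact ball_subset_ball (by linarith) (hsub z (ball_subset_ball (by linarith) hz))
      refine ⟨r / 16, by positivity, ?_⟩
      rw [Metric.tendstoUniformlyOn_iff] at hh1 ⊢
      intro ε hε
      filter_upwards [hh1 ε hε, hh1 (r / 4 / 16) (by positivity), hgood] with m hm1 hm2 hm3 z hz
      have hrr : ∀ w ∈ closedBall q (r / 4), w ∈ ball q (r / 2) :=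
        fun w hw => closedBall_subset_ball (by linarith) hw
      obtain ⟨ζ, hζ, rfl⟩ := closedBall_subset_image_of_near_id (F := h m) (y := q) (r := r / 4)
          (r' := r) (by positivity) (by linarith) (hh m hm3).1
          (fun w hw => by simpa only [Pi.zero_apply, dist_zero_left] using (hm2 w (hrr w hw)).le)
          (ball_subset_closedBall (by convert hz using 2; ring))
      rw [(hh m hm3).2.1 ζ (ball_subset_ball (by linarith) (hrr ζ hζ))]
      have := hm1 ζ (hrr ζ hζ)
      simp only [Pi.zero_apply, dist_zero_left] at this ⊢
      rwa [norm_sub_rev]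
  have huniv : U = Set.univ := IsClopen.eq_univ ⟨hclosed, hopen⟩ ⟨q₀, s₀, hs₀, h0⟩
  have hR0 : 0 < R := one_pos.trans_le hE.one_le
  have hl := (hlim (R : ℂ) (huniv ▸ Set.mem_univ _)).norm
  rw [norm_zero] at hl
  obtain ⟨m, hm⟩ := (hl.eventually_lt_const hR0).exists
  have hnR : ‖(R : ℂ)‖ = R := by simp [abs_of_pos hR0]
  have h1 := hE.pow_mul_le (hv m) (z := (R : ℂ)) hnR.ge
  have h2 : (2 : ℝ) ^ 1 ≤ 2 ^ (v m).length :=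
    pow_le_pow_right₀ (by norm_num) (List.length_pos_iff.2 (hv0 m))
  rw [hnR] at h1
  have h3 := norm_sub_norm_le (wd (v m) (R : ℂ)) (R : ℂ)
  rw [hnR] at h3
  nlinarith

/-- Nonempty words of a hyperbolic semigroup are at a definite distance from the identity on discs of
a given radius with centres in a compact set. -/
theorem exists_not_near_id {R : ℝ} {S : Set ℂ[X]} (hE : Escapes R S)
    (hH : ∀ z ∈ planarPC S, Tame S z) {M t : ℝ} (ht : 0 < t) :
    ∃ ε > 0, ∀ l : List ℂ[X], (∀ p ∈ l, p ∈ S) → l ≠ [] → ∀ y : ℂ, ‖y‖ ≤ M →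
      ∃ z ∈ ball y t, ε < ‖wd l z - z‖ := by
  by_contra! hcon
  have hpos : ∀ m : ℕ, (0 : ℝ) < 1 / ((m : ℝ) + 1) := fun m => by positivity
  choose v hv hv0 y hy hvy using fun m : ℕ => hcon (1 / ((m : ℝ) + 1)) (hpos m)
  obtain ⟨y₀, -, φ, hφ, hlim⟩ := (isCompact_closedBall (0 : ℂ) M).tendsto_subseq
    (fun m => mem_closedBall_zero_iff.2 (hy m))
  refine not_tendstoUniformlyOn_id hE hH (v := fun m => v (φ m)) (fun m => hv _)
    (fun m => hv0 _) (q₀ := y₀) (half_pos ht) ?_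
  rw [Metric.tendstoUniformlyOn_iff]
  intro ε hε
  have h1 : Tendsto (fun m => 1 / ((φ m : ℝ) + 1)) atTop (𝓝 0) :=
    tendsto_one_div_add_atTop_nhds_zero_nat.comp hφ.tendsto_atTop
  filter_upwards [h1.eventually_lt_const hε,
    hlim (ball_mem_nhds y₀ (half_pos ht))] with m hm1 hm2 z hz
  have hz' : z ∈ ball (y (φ m)) t := by
    rw [mem_ball] at hz ⊢
    have hm2' : dist (y (φ m)) y₀ < t / 2 := hm2
    have := dist_triangle_right z (y (φ m)) y₀
    linarith
  have := hvy (φ m) z hz'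
  simp only [Pi.zero_apply, dist_zero_left]
  linarith

/-! ### Contraction and expansion of long words -/

/-- If the derivative of a word at `x` is not small and its value there is bounded, then the
derivatives at `x` of all its right factors are bounded below: away from the postcritical set the
right factor has a bounded inverse branch, and near it the left factor is Lipschitz. -/
theorem exists_le_norm_deriv_right_factor {R : ℝ} {S : Set ℂ[X]} (hE : Escapes R S)
    (hH : ∀ z ∈ planarPC S, Tame S z) (M : ℝ) {η : ℝ} (hη : 0 < η) :
    ∃ c > 0, ∀ l₁ l₂ : List ℂ[X], (∀ p ∈ l₁, p ∈ S) → (∀ p ∈ l₂, p ∈ S) → ∀ x : ℂ,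
      ‖wd (l₁ ++ l₂) x‖ ≤ M → η ≤ ‖deriv (wd (l₁ ++ l₂)) x‖ → c ≤ ‖deriv (wd l₂) x‖ := by
  set M' := max M R with hM'
  have hM'1 : 1 ≤ M' := hE.one_le.trans (le_max_right _ _)
  have hK : IsCompact (planarPC S ∩ closedBall (0 : ℂ) (M' + 1)) :=
    (isCompact_closedBall _ _).inter_left isClosed_closure
  obtain ⟨s, hs, hsd⟩ := exists_uniform_tame (R := M' + 1) hK
    (fun z hz => hH z hz.1 _ (by linarith))
  set δ := min (s / 2) 1 with hδ
  have hδ0 : 0 < δ := by positivity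
  have hδ1 : δ ≤ 1 := min_le_right _ _
  have hδs : δ ≤ s / 2 := min_le_left _ _
  refine ⟨min (η / (8 * (M' + 1) / s)) (δ / (2 * (M' + 1))), by positivity,
    fun l₁ l₂ h₁ h₂ x hx hd => ?_⟩
  rw [wd_append] at hx
  set y := wd l₂ x with hy
  have hyM : ‖y‖ ≤ M' := hE.norm_le_of_norm_wd_le (le_max_right _ _) h₁ (hx.trans (le_max_left _ _))
  by_cases hnear : ∃ p ∈ planarPC S, dist y p < δ
  · obtain ⟨p, hp, hyp⟩ := hnear
    refine (min_le_left _ _).trans ?_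
    have hpK : p ∈ planarPC S ∩ closedBall (0 : ℂ) (M' + 1) := by
      refine ⟨hp, mem_closedBall_zero_iff.2 ?_⟩
      rw [dist_comm, dist_eq_norm] at hyp
      linarith [norm_le_norm_add_norm_sub' p y]
    have hsub : ball y (s / 2) ⊆ ball p s := ball_subset_ball' (by linarith)
    have hb : ∀ w ∈ ball p s, ‖wd l₁ w‖ ≤ 2 * (M' + 1) := by
      refine (hsd p hpK l₁ h₁).resolve_right fun h => ?_
      have := h y (hsub (mem_ball_self (half_pos hs)))
      linarith [le_max_left M R]
    have h3 := norm_deriv_le_of_norm_le (half_pos hs)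
      (differentiable_wd l₁).differentiableOn fun z hz => hb z (hsub hz)
    have h4 : 2 * (2 * (M' + 1)) / (s / 2) = 8 * (M' + 1) / s := by field_simp; ring
    rw [h4] at h3
    rw [deriv_wd_append, norm_mul] at hd
    rw [div_le_iff₀ (by positivity)]
    nlinarith [norm_nonneg (deriv (wd l₂) x)]
  · push Not at hnear
    refine (min_le_right _ _).trans ?_
    have hdisj : Disjoint (ball y δ) (planarPC S) := Set.disjoint_left.2 fun z hz hzP => by
      have := hnear z hzP
      rw [mem_ball, dist_comm] at hz
      linarith
    obtain ⟨h, h1, h2, h3, h4⟩ := exists_inverse_branch_wd hE (M := M' + 1)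
      (by linarith [le_max_right M R]) h₂ hδ0 hdisj (by linarith) (mem_ball_self hδ0)
    have h5 := deriv_inverse_branch_mul h1 h2 (mem_ball_self hδ0)
    rw [h3] at h5
    have h6 := norm_deriv_le_of_norm_le hδ0 h1 h4
    have h7 := congrArg norm h5
    rw [norm_mul, norm_one] at h7
    rw [le_div_iff₀ hδ0] at h6
    rw [div_le_iff₀ (by positivity)]
    nlinarith [norm_nonneg (deriv (wd l₂) x)]

/-- Long words of a hyperbolic semigroup contract wherever they are bounded. Otherwise two right
factors of a long word would be close to each other on a disc, and the quotient of the two would be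
a word close to the identity on a disc of definite size. -/
theorem exists_norm_deriv_lt {R : ℝ} {S : Set ℂ[X]} (hE : Escapes R S)
    (hH : ∀ z ∈ planarPC S, Tame S z) (M : ℝ) {t η : ℝ} (ht : 0 < t) (hη : 0 < η) :
    ∃ n, ∀ l : List ℂ[X], (∀ p ∈ l, p ∈ S) → n ≤ l.length → ∀ x : ℂ,
      (∀ z ∈ ball x t, ‖wd l z‖ ≤ M) → ‖deriv (wd l) x‖ < η := by
  obtain ⟨c, hc, hcl⟩ := exists_le_norm_deriv_right_factor hE hH M hη
  set M' := max M R with hM'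
  have hM'0 : 0 < M' := by linarith [hE.one_le, le_max_right M R]
  obtain ⟨t', ht', himg⟩ := exists_ball_subset_image (half_pos ht) hM'0 hc
  obtain ⟨ε, hε, hid⟩ := exists_not_near_id hE hH (M := M') ht'
  obtain ⟨N, hN⟩ := exists_pair_close ht hM'0 hε
  refine ⟨N, fun l hl hlen x hx => ?_⟩
  by_contra! hbig
  have htake : ∀ k, ∀ p ∈ l.take k, p ∈ S := fun k p hp => hl p (List.mem_of_mem_take hp)
  have hdrop : ∀ k, ∀ p ∈ l.drop k, p ∈ S := fun k p hp => hl p (List.mem_of_mem_drop hp)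
  have hbd : ∀ k, ∀ z ∈ ball x t, ‖wd (l.drop k) z‖ ≤ M' := fun k z hz =>
    hE.norm_le_of_norm_wd_le (le_max_right _ _) (htake k) (by
      rw [← wd_append, List.take_append_drop]
      exact (hx z hz).trans (le_max_left _ _))
  obtain ⟨i, j, hij, hjN, hclose⟩ := hN (fun k => wd (l.drop (l.length - k))) x
    (fun k _ => ⟨(differentiable_wd _).differentiableOn, hbd _⟩)
  set u := l.drop (l.length - i) with hu
  set v := (l.drop (l.length - j)).take (j - i) with hv
  have hvu : l.drop (l.length - j) = v ++ u := by
    conv_lhs => rw [← List.take_append_drop (j - i) (l.drop (l.length - j))]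
    rw [List.drop_drop, hv, hu]
    congr 2
    omega
  have hv0 : v ≠ [] := by
    rw [← List.length_pos_iff, hv, List.length_take, List.length_drop]
    omega
  have hvS : ∀ p ∈ v, p ∈ S := fun p hp => hdrop _ p (List.mem_of_mem_take hp)
  have hcu : c ≤ ‖deriv (wd u) x‖ := by
    refine hcl (l.take (l.length - i)) u (htake _) (hdrop _) x ?_ ?_
    · rw [hu, List.take_append_drop]; exact hx x (mem_ball_self ht)
    · rw [hu, List.take_append_drop]; exact hbig
  have hsub : ball x (t / 2) ⊆ ball x t := ball_subset_ball (by linarith)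
  have hcov := himg (wd u) x (differentiable_wd u).differentiableOn
    (fun z hz => hbd _ z (hsub hz)) hcu
  obtain ⟨z, hz, hzε⟩ := hid v hvS hv0 (wd u x) (hbd _ x (mem_ball_self ht))
  obtain ⟨w, hw, rfl⟩ := hcov hz
  have h1 := hclose w hw
  simp only [hvu, wd_append] at h1
  rw [norm_sub_rev] at h1
  linarith

/-- Long words of a hyperbolic semigroup expand at points sent away from the postcritical set. -/
theorem exists_le_norm_deriv {R : ℝ} {S : Set ℂ[X]} (hE : Escapes R S)
    (hH : ∀ z ∈ planarPC S, Tame S z) (M : ℝ) {s C : ℝ} (hs : 0 < s) (hC : 0 < C) :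
    ∃ n, ∀ l : List ℂ[X], (∀ p ∈ l, p ∈ S) → n ≤ l.length → ∀ x : ℂ,
      ‖wd l x‖ ≤ M → Disjoint (ball (wd l x) s) (planarPC S) → C ≤ ‖deriv (wd l) x‖ := by
  set M₁ := max R (M + s) with hM₁
  have hM₁0 : 0 < M₁ := by linarith [hE.one_le, le_max_left R (M + s)]
  obtain ⟨t, ht, himg⟩ := exists_ball_subset_image hs hM₁0 (one_div_pos.2 hC)
  obtain ⟨n, hn⟩ := exists_norm_deriv_lt hE hH M₁ ht (show 0 < s / (2 * M₁) by positivity)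
  refine ⟨n, fun l hl hlen x hx hdisj => ?_⟩
  by_contra! hlt
  have hys := mem_ball_self (x := wd l x) hs
  have hball : ∀ z ∈ ball (wd l x) s, ‖z‖ ≤ M₁ := fun z hz => by
    rw [mem_ball, dist_eq_norm] at hz
    linarith [norm_le_norm_add_norm_sub' z (wd l x), le_max_right R (M + s)]
  obtain ⟨h, h1, h2, h3, h4⟩ := exists_inverse_branch_wd hE (le_max_left R (M + s)) hl hs hdisj
    (by linarith [le_max_right R (M + s)]) hys
  have h5 := congrArg norm (deriv_inverse_branch_mul h1 h2 hys)
  rw [h3, norm_mul, norm_one] at h5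
  have h6 : 1 / C ≤ ‖deriv h (wd l x)‖ := by
    rw [div_le_iff₀ hC]
    nlinarith [norm_nonneg (deriv h (wd l x))]
  have hcov := himg h (wd l x) h1 h4 h6
  rw [h3] at hcov
  have h7 := hn l hl hlen x fun z hz => by
    obtain ⟨w, hw, rfl⟩ := hcov hz
    rw [h2 w hw]
    exact hball w hw
  have h8 := norm_deriv_le_of_norm_le hs h1 h4
  rw [le_div_iff₀ hs] at h8
  rw [lt_div_iff₀ (by positivity)] at h7
  nlinarith [norm_nonneg (deriv (wd l) x), norm_nonneg (deriv h (wd l x))]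

/-! ### Attracting neighbourhoods of the postcritical set -/

/-- The neighbourhood of the postcritical set and of infinity formed by the points within `δ` of the
former or of modulus larger than `R`. -/
def attracting (S : Set ℂ[X]) (δ R : ℝ) : Set ℂ := thickening δ (planarPC S) ∪ {z | R < ‖z‖}

theorem attracting_mono {S : Set ℂ[X]} {δ δ' R R' : ℝ} (hδ : δ ≤ δ') (hR : R' ≤ R) :
    attracting S δ R ⊆ attracting S δ' R' :=
  Set.union_subset_union (thickening_mono hδ _) fun _ h => hR.trans_lt h

/-- Long words contract the distances to points of the postcritical set by an arbitrary factor, as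
long as one of the two image points stays bounded; the size `δ₀` of the neighbourhood does not
depend on the factor. -/
theorem exists_norm_wd_sub_le {R : ℝ} {S : Set ℂ[X]} (hE : Escapes R S)
    (hH : ∀ z ∈ planarPC S, Tame S z) (M : ℝ) :
    ∃ δ₀ > 0, ∀ η > 0, ∃ n, ∀ l : List ℂ[X], (∀ p ∈ l, p ∈ S) → n ≤ l.length →
      ∀ p ∈ planarPC S, ∀ x ∈ ball p δ₀, ‖wd l x‖ ≤ M ∨ ‖wd l p‖ ≤ M →
        ‖wd l x - wd l p‖ ≤ η * ‖x - p‖ := by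
  set M' := max M R with hM'
  have hM'1 : 1 ≤ M' := hE.one_le.trans (le_max_right _ _)
  have hK : IsCompact (planarPC S ∩ closedBall (0 : ℂ) (M' + 1)) :=
    (isCompact_closedBall _ _).inter_left isClosed_closure
  obtain ⟨s, hs, hsd⟩ := exists_uniform_tame (R := M' + 1) hK
    (fun z hz => hH z hz.1 _ (by linarith))
  refine ⟨min (s / 2) 1, by positivity, fun η hη => ?_⟩
  obtain ⟨n, hn⟩ := exists_norm_deriv_lt hE hH (2 * (M' + 1)) (half_pos hs) hη
  refine ⟨n, fun l hl hlen p hp x hx hM => ?_⟩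
  have hx1 : ‖x - p‖ < 1 := by
    rw [← dist_eq_norm]; exact (mem_ball.1 hx).trans_le (min_le_right _ _)
  have hxs : x ∈ ball p (s / 2) := ball_subset_ball (min_le_left _ _) hx
  have hpK : ‖p‖ ≤ M' + 1 := by
    rcases hM with h | h
    · have := hE.norm_le_of_norm_wd_le (le_max_right M R) hl (h.trans (le_max_left M R))
      rw [norm_sub_rev] at hx1
      linarith [norm_le_norm_add_norm_sub' p x]
    · have := hE.norm_le_of_norm_wd_le (le_max_right M R) hl (h.trans (le_max_left M R))
      linarith
  have hb : ∀ w ∈ ball p s, ‖wd l w‖ ≤ 2 * (M' + 1) := by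
    refine (hsd p ⟨hp, mem_closedBall_zero_iff.2 hpK⟩ l hl).resolve_right fun h => ?_
    have h1 := h x (ball_subset_ball (by linarith) hxs)
    have h2 := h p (mem_ball_self hs)
    have := le_max_left M R
    rcases hM with h | h <;> linarith
  refine norm_sub_le_of_norm_deriv_le (differentiable_wd l).differentiableOn (fun z hz => ?_)
    hxs (mem_ball_self (half_pos hs))
  refine (hn l hl hlen z fun w hw => hb w (ball_subset_ball' ?_ hw)).le
  rw [mem_ball] at hz
  linarith

/-- Long words map the attracting neighbourhoods well inside themselves. When the postcritical set is
bounded the same holds for its neighbourhoods alone. -/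
theorem exists_wd_mem_attracting {R R₁ : ℝ} {S : Set ℂ[X]} (hE : Escapes R S)
    (hH : ∀ z ∈ planarPC S, Tame S z) (hR : R ≤ R₁) :
    ∃ δ₀ > 0, ∀ δ > 0, δ ≤ δ₀ → ∃ n, ∀ l : List ℂ[X], (∀ p ∈ l, p ∈ S) → n ≤ l.length →
      (∀ x ∈ attracting S δ R₁, wd l x ∈ attracting S (δ / 2) (R₁ + 1)) ∧
      (planarPC S ⊆ closedBall 0 R₁ → ∀ x ∈ thickening δ (planarPC S),
        wd l x ∈ thickening (δ / 2) (planarPC S)) := by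
  have hR1 : 1 ≤ R₁ := hE.one_le.trans hR
  obtain ⟨δ₀, hδ₀, hcon⟩ := exists_norm_wd_sub_le hE hH (R₁ + 1)
  refine ⟨δ₀, hδ₀, fun δ hδ hδδ => ?_⟩
  obtain ⟨n, hn⟩ := hcon (1 / 4) (by norm_num)
  have key : ∀ l : List ℂ[X], (∀ p ∈ l, p ∈ S) → n ≤ l.length → ∀ p ∈ planarPC S,
      ∀ x, dist x p < δ → ‖wd l x‖ ≤ R₁ + 1 ∨ ‖wd l p‖ ≤ R₁ + 1 →
        wd l x ∈ thickening (δ / 2) (planarPC S) := by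
    intro l hl hlen p hp x hxp hM
    rw [mem_thickening_iff]
    refine ⟨wd l p, wd_mem_planarPC hl hp, ?_⟩
    have := hn l hl hlen p hp x (hxp.trans_le hδδ) hM
    rw [dist_eq_norm] at hxp ⊢
    linarith
  refine ⟨max n 1, fun l hl hlen => ⟨fun x hx => ?_, fun hP x hx => ?_⟩⟩
  · by_cases hbig : R₁ + 1 < ‖wd l x‖
    · exact Or.inr hbig
    push Not at hbig
    rcases hx with hx | hx
    · obtain ⟨p, hp, hxp⟩ := mem_thickening_iff.1 hx
      exact Or.inl (key l hl ((le_max_left _ _).trans hlen) p hp x hxp (Or.inl hbig))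
    · exfalso
      have hx' : R₁ < ‖x‖ := hx
      have h1 := hE.pow_mul_le hl (hR.trans hx'.le)
      have h2 : (2 : ℝ) ^ 1 ≤ 2 ^ l.length :=
        pow_le_pow_right₀ (by norm_num) ((le_max_right _ _).trans hlen)
      nlinarith
  · obtain ⟨p, hp, hxp⟩ := mem_thickening_iff.1 hx
    refine key l hl ((le_max_left _ _).trans hlen) p hp x hxp (Or.inr ?_)
    have := mem_closedBall_zero_iff.1 (hP (wd_mem_planarPC hl hp))
    linarith

/-- Compact subsets of the Fatou set are absorbed by the attracting neighbourhoods: bounded long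
words contract there, and would expand if they missed the neighbourhood. -/
theorem exists_wd_mem_attracting_of_isCompact {R : ℝ} {S : Set ℂ[X]} (hE : Escapes R S)
    (hH : ∀ z ∈ planarPC S, Tame S z) {K : Set ℂ} (hK : IsCompact K) (hKT : ∀ z ∈ K, Tame S z)
    {δ R₁ : ℝ} (hδ : 0 < δ) (hR₁ : 0 < R₁) :
    ∃ n, ∀ l : List ℂ[X], (∀ p ∈ l, p ∈ S) → n ≤ l.length → ∀ x ∈ K,
      wd l x ∈ attracting S δ R₁ := by
  obtain ⟨s, hs, hsd⟩ := exists_uniform_tame (R := R₁ + 1) hK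
    (fun z hz => hKT z hz _ (by linarith))
  obtain ⟨n₁, hn₁⟩ := exists_norm_deriv_lt hE hH (2 * (R₁ + 1)) hs one_pos
  obtain ⟨n₂, hn₂⟩ := exists_le_norm_deriv hE hH R₁ hδ one_pos
  refine ⟨max n₁ n₂, fun l hl hlen x hx => ?_⟩
  by_contra hnot
  rw [attracting, Set.mem_union, not_or] at hnot
  have hle : ‖wd l x‖ ≤ R₁ := not_lt.1 hnot.2
  have hdisj : Disjoint (ball (wd l x) δ) (planarPC S) := Set.disjoint_left.2 fun z hz hzP =>
    hnot.1 (mem_thickening_iff.2 ⟨z, hzP, by rwa [dist_comm]⟩)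
  have hb : ∀ w ∈ ball x s, ‖wd l w‖ ≤ 2 * (R₁ + 1) := by
    refine (hsd x hx l hl).resolve_right fun h => ?_
    linarith [h x (mem_ball_self hs)]
  exact absurd (hn₁ l hl ((le_max_left _ _).trans hlen) x hb)
    (not_lt.2 (hn₂ l hl ((le_max_right _ _).trans hlen) x hle hdisj))

/-! ### Perturbation of words -/

/-- `S` is uniformly bounded on each disc. -/
def LocBdd (S : Set ℂ[X]) : Prop := ∀ M : ℝ, ∃ B : ℝ, ∀ p ∈ S, ∀ z : ℂ, ‖z‖ ≤ M → ‖p.eval z‖ ≤ B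

/-- Closeness of two polynomials on the disc of radius `M`. -/
def CloseOn (M η : ℝ) (p q : ℂ[X]) : Prop := ∀ z : ℂ, ‖z‖ ≤ M → ‖p.eval z - q.eval z‖ ≤ η

theorem CloseOn.symm {M η : ℝ} {p q : ℂ[X]} (h : CloseOn M η p q) : CloseOn M η q p :=
  fun z hz => by rw [norm_sub_rev]; exact h z hz

theorem CloseOn.mono {M M' η η' : ℝ} {p q : ℂ[X]} (h : CloseOn M η p q) (hM : M' ≤ M)
    (hη : η ≤ η') : CloseOn M' η' p q := fun z hz => (h z (hz.trans hM)).trans hη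

theorem LocBdd.exists_norm_wd_le {S : Set ℂ[X]} (hB : LocBdd S) (n : ℕ) (M : ℝ) :
    ∃ B : ℝ, ∀ l : List ℂ[X], (∀ p ∈ l, p ∈ S) → l.length ≤ n → ∀ z : ℂ, ‖z‖ ≤ M →
      ‖wd l z‖ ≤ B := by
  induction n with
  | zero =>
    refine ⟨M, fun l _ hlen z hz => ?_⟩
    rw [List.length_eq_zero_iff.1 (Nat.le_zero.1 hlen), wd_nil]
    exact hz
  | succ n ih =>
    obtain ⟨B, hBn⟩ := ih
    obtain ⟨B', hB'⟩ := hB B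
    refine ⟨max M B', fun l hl hlen z hz => ?_⟩
    cases l with
    | nil => rw [wd_nil]; exact hz.trans (le_max_left _ _)
    | cons p l =>
      rw [wd_cons]
      refine (hB' p (hl p List.mem_cons_self) _ (hBn l
        (fun q hq => hl q (List.mem_cons_of_mem _ hq)) ?_ z hz)).trans (le_max_right _ _)
      simpa using hlen

theorem LocBdd.exists_lipschitz {S : Set ℂ[X]} (hB : LocBdd S) (M : ℝ) :
    ∃ L ≥ 0, ∀ p ∈ S, ∀ z w : ℂ, ‖z‖ ≤ M → ‖w‖ ≤ M → ‖p.eval z - p.eval w‖ ≤ L * ‖z - w‖ := by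
  by_cases hM : 0 ≤ M
  · obtain ⟨B, hB'⟩ := hB (2 * (M + 1))
    have ht : 0 < 2 * (M + 1) := by linarith
    refine ⟨max 0 (4 * B / (2 * (M + 1))), le_max_left _ _, fun p hp z w hz hw => ?_⟩
    refine (norm_sub_le_of_norm_le (x := 0) ht p.differentiable.differentiableOn
      (fun z hz => hB' p hp z (mem_ball_zero_iff.1 hz).le) ?_ ?_).trans
      (mul_le_mul_of_nonneg_right (le_max_right _ _) (norm_nonneg _))
    · rw [mem_ball_zero_iff]; linarith
    · rw [mem_ball_zero_iff]; linarith
  · exact ⟨0, le_rfl, fun p hp z w hz _ => absurd ((norm_nonneg z).trans hz) hM⟩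

/-- Words of bounded length depend continuously on their letters and on the point, uniformly on
discs. -/
theorem LocBdd.exists_norm_wd_sub_wd_le {S : Set ℂ[X]} (hB : LocBdd S) (n : ℕ) (M : ℝ) {η : ℝ}
    (hη : 0 < η) :
    ∃ M₁ : ℝ, ∃ η₁ > 0, ∀ l l' : List ℂ[X], (∀ p ∈ l, p ∈ S) →
      List.Forall₂ (CloseOn M₁ η₁) l l' → l.length ≤ n → ∀ z z' : ℂ, ‖z‖ ≤ M → ‖z - z'‖ ≤ η₁ →
        ‖wd l z - wd l' z'‖ ≤ η := by
  induction n generalizing η with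
  | zero =>
    refine ⟨0, η, hη, fun l l' _ hll hlen z z' _ hzz => ?_⟩
    obtain rfl := List.length_eq_zero_iff.1 (Nat.le_zero.1 hlen)
    obtain rfl := List.forall₂_nil_left_iff.1 hll
    simpa using hzz
  | succ n ih =>
    obtain ⟨B, hBn⟩ := hB.exists_norm_wd_le n M
    obtain ⟨L, hL0, hL⟩ := hB.exists_lipschitz (B + 1)
    obtain ⟨M₁, η₁, hη₁, h₁⟩ := ih (η := min 1 (η / (2 * (L + 1)))) (by positivity)
    refine ⟨max M₁ (B + 1), min η₁ (η / 2), by positivity, fun l l' hl hll hlen z z' hz hzz => ?_⟩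
    cases hll with
    | nil =>
      simp only [wd_nil]
      exact hzz.trans ((min_le_right _ _).trans (by linarith))
    | @cons p p' l l' hpp hll =>
      have hl' : ∀ q ∈ l, q ∈ S := fun q hq => hl q (List.mem_cons_of_mem _ hq)
      have hlen' : l.length ≤ n := by simpa using hlen
      have h2 := h₁ l l' hl' (hll.imp fun _ _ h => h.mono (le_max_left _ _) (min_le_left _ _))
        hlen' z z' hz (hzz.trans (min_le_left _ _))
      have h3 := hBn l hl' hlen' z hz
      have h4 : ‖wd l' z'‖ ≤ B + 1 := by
        have := h2.trans (min_le_left _ _)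
        rw [norm_sub_rev] at this
        linarith [norm_le_norm_add_norm_sub' (wd l' z') (wd l z)]
      have h5 := hL p (hl p List.mem_cons_self) _ _ (h3.trans (by linarith)) h4
      have h6 := (hpp _ (h4.trans (le_max_right _ _))).trans (min_le_right _ _)
      have h7 : L * ‖wd l z - wd l' z'‖ ≤ η / 2 := by
        have h8 := h2.trans (min_le_right _ _)
        rw [le_div_iff₀ (by positivity)] at h8
        nlinarith [norm_nonneg (wd l z - wd l' z')]
      rw [wd_cons, wd_cons]
      have h9 : p.eval (wd l z) - p'.eval (wd l' z') =
        (p.eval (wd l z) - p.eval (wd l' z')) + (p.eval (wd l' z') - p'.eval (wd l' z')) := by ring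
      rw [h9]
      linarith [norm_add_le (p.eval (wd l z) - p.eval (wd l' z'))
        (p.eval (wd l' z') - p'.eval (wd l' z'))]

/-- Letterwise choice of a word related to a given one. -/
theorem exists_forall₂_of_forall_exists {S : Set ℂ[X]} {r : ℂ[X] → ℂ[X] → Prop}
    {l : List ℂ[X]} (h : ∀ p ∈ l, ∃ q ∈ S, r p q) :
    ∃ l' : List ℂ[X], (∀ q ∈ l', q ∈ S) ∧ List.Forall₂ r l l' := by
  induction l with
  | nil => exact ⟨[], by simp, .nil⟩
  | cons p l ih =>
    obtain ⟨l', h1, h2⟩ := ih fun q hq => h q (List.mem_cons_of_mem _ hq)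
    obtain ⟨q, hq, hr⟩ := h p List.mem_cons_self
    refine ⟨q :: l', fun q' hq' => ?_, .cons hr h2⟩
    rcases List.mem_cons.1 hq' with rfl | h'
    exacts [hq, h1 q' h']

/-- Every long word maps a set `V` into itself as soon as the words with lengths between `n` and
`2 * n` do. -/
theorem mapsTo_of_mapsTo_blocks {S : Set ℂ[X]} {V : Set ℂ} {n : ℕ} (hn : 0 < n)
    (h : ∀ l : List ℂ[X], (∀ p ∈ l, p ∈ S) → n ≤ l.length → l.length ≤ 2 * n → ∀ x ∈ V, wd l x ∈ V)
    {l : List ℂ[X]} (hl : ∀ p ∈ l, p ∈ S) (hlen : n ≤ l.length) {x : ℂ} (hx : x ∈ V) :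
    wd l x ∈ V := by
  induction hk : l.length using Nat.strong_induction_on generalizing l with
  | _ k ih =>
    by_cases h2 : l.length ≤ 2 * n
    · exact h l hl hlen h2 x hx
    · have h3 : wd (l.drop n) x ∈ V := ih (k - n) (by omega)
        (fun p hp => hl p (List.mem_of_mem_drop hp)) (by rw [List.length_drop]; omega)
        (by rw [List.length_drop, hk])
      rw [← List.take_append_drop n l, wd_append]
      exact h _ (fun p hp => hl p (List.mem_of_mem_take hp)) (by rw [List.length_take]; omega)
        (by rw [List.length_take]; omega) _ h3

/-- Persistence of the attracting neighbourhoods: for `S'` close to the hyperbolic `S` they contain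
the critical orbits of `S'`, and they absorb a given compact subset of the Fatou set of `S`. -/
theorem exists_close_attracting {R R₁ : ℝ} {S : Set ℂ[X]} (hE : Escapes R S) (hB : LocBdd S)
    (hH : ∀ z ∈ planarPC S, Tame S z) (hR : R ≤ R₁) {K : Set ℂ} (hK : IsCompact K)
    (hKT : ∀ z ∈ K, Tame S z) {B₀ : ℝ}
    (hB₀ : ∀ p ∈ S, ∀ c : ℂ, p.derivative.eval c = 0 → ‖p.eval c‖ ≤ B₀) {δ₁ : ℝ} (hδ₁ : 0 < δ₁) :
    ∃ M : ℝ, ∃ η > 0, ∃ n, ∀ S' : Set ℂ[X], Escapes R S' →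
      (∀ p' ∈ S', ∃ p ∈ S, CloseOn M η p' p) →
      (∀ p' ∈ S', ∀ c', p'.derivative.eval c' = 0 → ∃ p ∈ S, ∃ c, p.derivative.eval c = 0 ∧
        ‖p.eval c - p'.eval c'‖ ≤ η) →
      critOrbit S' ⊆ attracting S δ₁ R₁ ∧
      (∀ l : List ℂ[X], (∀ p ∈ l, p ∈ S') → n ≤ l.length → ∀ x ∈ K,
        wd l x ∈ attracting S δ₁ R₁) ∧
      (planarPC S ⊆ closedBall 0 R₁ → critOrbit S' ⊆ thickening δ₁ (planarPC S)) := by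
  have hR1 : 1 ≤ R₁ := hE.one_le.trans hR
  obtain ⟨δ₀, hδ₀, htrap⟩ := exists_wd_mem_attracting hE hH hR
  set δ := min (min δ₀ δ₁) 1 with hδdef
  have hδ : 0 < δ := by positivity
  have hδ₁' : δ ≤ δ₁ := (min_le_left _ _).trans (min_le_right _ _)
  have hδ1 : δ ≤ 1 := min_le_right _ _
  obtain ⟨n₁, hn₁⟩ := htrap δ hδ ((min_le_left _ _).trans (min_le_left _ _))
  obtain ⟨n₂, hn₂⟩ := exists_wd_mem_attracting_of_isCompact hE hH hK hKT (half_pos hδ)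
    (show 0 < R₁ + 1 by linarith)
  set n := max (max n₁ n₂) 1 with hn
  have hn0 : 0 < n := lt_of_lt_of_le one_pos (le_max_right _ _)
  have hnn₁ : n₁ ≤ n := (le_max_left _ _).trans (le_max_left _ _)
  have hnn₂ : n₂ ≤ n := (le_max_right _ _).trans (le_max_left _ _)
  obtain ⟨BK, hBK⟩ := hK.isBounded.exists_norm_le
  obtain ⟨M, η, hη, hclose⟩ := hB.exists_norm_wd_sub_wd_le (2 * n) (max (max (R₁ + 1) BK) B₀)
    (half_pos hδ)
  refine ⟨M, η, hη, n, fun S' hE' hS' hC' => ?_⟩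
  have hword : ∀ l' : List ℂ[X], (∀ p ∈ l', p ∈ S') → l'.length ≤ 2 * n →
      ∃ l : List ℂ[X], (∀ p ∈ l, p ∈ S) ∧ l.length = l'.length ∧
        ∀ z z' : ℂ, ‖z‖ ≤ max (max (R₁ + 1) BK) B₀ → ‖z - z'‖ ≤ η →
          ‖wd l' z' - wd l z‖ ≤ δ / 2 := by
    intro l' hl' hlen
    obtain ⟨l, hl, hll⟩ := exists_forall₂_of_forall_exists fun p hp => hS' p (hl' p hp)
    have hle := hll.length_eq
    refine ⟨l, hl, hle.symm, fun z z' hz hzz => ?_⟩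
    rw [norm_sub_rev]
    exact hclose l l' hl (hll.flip.imp fun _ _ h => CloseOn.symm h) (hle ▸ hlen) z z' hz hzz
  have hth : ∀ z z' : ℂ, ‖z' - z‖ ≤ δ / 2 → z ∈ thickening (δ / 2) (planarPC S) →
      z' ∈ thickening δ (planarPC S) := fun z z' hzz hz => by
    obtain ⟨p, hp, hzp⟩ := mem_thickening_iff.1 hz
    refine mem_thickening_iff.2 ⟨p, hp, ?_⟩
    rw [← dist_eq_norm] at hzz
    linarith [dist_triangle z' z p]
  have hatt : ∀ z z' : ℂ, ‖z' - z‖ ≤ δ / 2 → z ∈ attracting S (δ / 2) (R₁ + 1) →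
      z' ∈ attracting S δ R₁ := fun z z' hzz hz => by
    rcases hz with hz | hz
    · exact Or.inl (hth z z' hzz hz)
    · refine Or.inr ?_
      have hz' : R₁ + 1 < ‖z‖ := hz
      rw [norm_sub_rev] at hzz
      show R₁ < ‖z'‖
      linarith [norm_le_norm_add_norm_sub' z z']
  -- words of lengths between `n` and `2 * n` are handled by approximation, longer ones by cutting
  -- them into such blocks
  have hV : ∀ l : List ℂ[X], (∀ p ∈ l, p ∈ S') → n ≤ l.length →
      ∀ x ∈ attracting S δ R₁, wd l x ∈ attracting S δ R₁ := fun l hl hlen x hx => by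
    refine mapsTo_of_mapsTo_blocks hn0 (fun l' hl' h1 h2 x hx => ?_) hl hlen hx
    by_cases hbig : R₁ < ‖x‖
    · exact Or.inr (hbig.trans_le (hE'.le_norm_wd hl' (hR.trans hbig.le)))
    · obtain ⟨l, hl, hlen, hlx⟩ := hword l' hl' h2
      refine hatt _ _ (hlx x x ?_ (by simpa using hη.le))
        ((hn₁ l hl (by omega)).1 x hx)
      exact (not_lt.1 hbig).trans ((by linarith : R₁ ≤ R₁ + 1).trans
        ((le_max_left _ _).trans (le_max_left _ _)))
  have hshort : ∀ l : List ℂ[X], (∀ p ∈ l, p ∈ S') → l.length ≤ 2 * n → ∀ p ∈ S', ∀ c,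
      p.derivative.eval c = 0 → wd l (p.eval c) ∈ thickening δ (planarPC S) := by
    intro l' hl' hlen p' hp' c' hc'
    obtain ⟨p, hp, c, hc, hpc⟩ := hC' p' hp' c' hc'
    obtain ⟨l, hl, hlen', hlx⟩ := hword l' hl' hlen
    have h1 := hlx _ _ ((hB₀ p hp c hc).trans (le_max_right _ _)) hpc
    refine mem_thickening_iff.2 ⟨wd l (p.eval c), subset_closure ⟨l, hl, p, hp, c, hc, rfl⟩, ?_⟩
    rw [dist_eq_norm]
    linarith
  refine ⟨?_, fun l hl hlen x hx => ?_, fun hPC => ?_⟩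
  · rintro _ ⟨l, hl, p, hp, c, hc, rfl⟩
    refine attracting_mono hδ₁' le_rfl ?_
    by_cases h2 : l.length ≤ 2 * n
    · exact Or.inl (hshort l hl h2 p hp c hc)
    · exact hV l hl (by omega) _ (Or.inl (by simpa using hshort [] (by simp) (by simp) p hp c hc))
  · refine attracting_mono hδ₁' le_rfl ?_
    have hKn : ∀ l' : List ℂ[X], (∀ p ∈ l', p ∈ S') → n ≤ l'.length → l'.length ≤ 2 * n →
        wd l' x ∈ attracting S δ R₁ := fun l' hl' h1 h2 => by
      obtain ⟨l, hl, hlen, hlx⟩ := hword l' hl' h2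
      exact hatt _ _ (hlx x x ((hBK x hx).trans ((le_max_right _ _).trans (le_max_left _ _)))
        (by simpa using hη.le)) (hn₂ l hl (by omega) x hx)
    by_cases h2 : l.length ≤ 2 * n
    · exact hKn l hl hlen h2
    · rw [← List.take_append_drop (l.length - n) l, wd_append]
      refine hV _ (fun p hp => hl p (List.mem_of_mem_take hp)) (by rw [List.length_take]; omega) _
        (hKn _ (fun p hp => hl p (List.mem_of_mem_drop hp)) ?_ ?_) <;>
      · rw [List.length_drop]; omega
  · have hVb : ∀ l : List ℂ[X], (∀ p ∈ l, p ∈ S') → n ≤ l.length →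
        ∀ x ∈ thickening δ (planarPC S), wd l x ∈ thickening δ (planarPC S) :=
        fun l hl hlen x hx => by
      refine mapsTo_of_mapsTo_blocks hn0 (fun l' hl' h1 h2 x hx => ?_) hl hlen hx
      obtain ⟨l, hl, hlen, hlx⟩ := hword l' hl' h2
      refine hth _ _ (hlx x x ?_ (by simpa using hη.le))
        ((hn₁ l hl (by omega)).2 hPC x hx)
      obtain ⟨p, hp, hxp⟩ := mem_thickening_iff.1 hx
      have hp1 := mem_closedBall_zero_iff.1 (hPC hp)
      rw [dist_eq_norm] at hxp
      have := norm_le_norm_add_norm_sub' x p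
      exact (by linarith : ‖x‖ ≤ R₁ + 1).trans ((le_max_left _ _).trans (le_max_left _ _))
    rintro _ ⟨l, hl, p, hp, c, hc, rfl⟩
    refine thickening_mono hδ₁' _ ?_
    by_cases h2 : l.length ≤ 2 * n
    · exact hshort l hl h2 p hp c hc
    · exact hVb l hl (by omega) _ (by simpa using hshort [] (by simp) (by simp) p hp c hc)

/-! ### Bounded orbits and shadowing -/

/-- On a connected set of tame points, boundedness of the orbit along a fixed sequence of letters
is an open and closed condition. -/
theorem norm_orbit_le_of_isPreconnected {R R₁ : ℝ} {S : Set ℂ[X]} (hE : Escapes R S)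
    (hR : R ≤ R₁) {D : Set ℂ} (hD : IsPreconnected D) (hDT : ∀ z ∈ D, Tame S z)
    {b L : ℕ → List ℂ[X]} (hb : ∀ k, ∀ p ∈ b k, p ∈ S) (hb0 : ∀ k, b k ≠ [])
    (hL : ∀ k, ∀ p ∈ L k, p ∈ S) (hLb : ∀ k, L (k + 1) = b k ++ L k) {z₀ : ℂ} (hz₀ : z₀ ∈ D)
    (h₀ : ∀ k, ‖wd (L k) z₀‖ ≤ R₁) : ∀ z ∈ D, ∀ k, ‖wd (L k) z‖ ≤ R₁ := by
  set A : Set ℂ := {z | ∀ k, ‖wd (L k) z‖ ≤ R₁} with hA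
  have hR1 : 1 ≤ R₁ := hE.one_le.trans hR
  have hclosed : IsClosed A := by
    rw [hA, Set.ofPred_forall]
    exact isClosed_iInter fun k =>
      isClosed_le (differentiable_wd _).continuous.norm continuous_const
  have hint : ∀ z ∈ D, z ∈ A → z ∈ interior A := by
    intro z hzD hzA
    obtain ⟨s, hs, hsd⟩ := hDT z hzD (R₁ + 1) (by linarith)
    refine mem_interior.2 ⟨ball z s, fun w hw k => ?_, isOpen_ball, mem_ball_self hs⟩
    have hbd : ∀ k, ‖wd (L k) w‖ ≤ 2 * (R₁ + 1) := fun k => by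
      refine (hsd (L k) (hL k)).resolve_right (fun h => ?_) w hw
      linarith [h z (mem_ball_self hs), hzA k]
    by_contra! hgt
    -- once the orbit leaves the disc of radius `R₁` it grows at least geometrically
    have hgrow : ∀ m : ℕ, 2 ^ m * R₁ < ‖wd (L (k + m)) w‖ := by
      intro m
      induction m with
      | zero => simpa using hgt
      | succ m ih =>
        have h1 : (1 : ℝ) ≤ 2 ^ m := one_le_pow₀ (by norm_num)
        have h2 : R ≤ ‖wd (L (k + m)) w‖ := by nlinarith
        have h3 := hE.pow_mul_le (hb (k + m)) h2
        have h4 : (2 : ℝ) ^ 1 ≤ 2 ^ (b (k + m)).length :=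
          pow_le_pow_right₀ (by norm_num) (List.length_pos_iff.2 (hb0 _))
        rw [← add_assoc, hLb, wd_append, pow_succ]
        nlinarith [norm_nonneg (wd (L (k + m)) w)]
    obtain ⟨m, hm⟩ := pow_unbounded_of_one_lt (2 * (R₁ + 1)) (one_lt_two (α := ℝ))
    have h5 := hgrow m
    have h6 := hbd (k + m)
    have h7 : (0 : ℝ) < 2 ^ m := by positivity
    nlinarith
  have := hD.subset_of_closure_inter_subset (u := interior A) isOpen_interior
    ⟨z₀, hz₀, hint z₀ hz₀ h₀⟩
    (fun z hz => hint z hz.2 (hclosed.closure_subset (closure_mono interior_subset hz.1)))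
  exact fun z hz => interior_subset (this hz)

/-- A semigroup containing a polynomial of degree at least two has points that are not tame:
otherwise boundedness of the orbit under that polynomial would be an open and closed condition; it
holds at a fixed point, but not at points of large modulus. -/
theorem exists_not_tame {R : ℝ} {S : Set ℂ[X]} (hE : Escapes R S) {p : ℂ[X]} (hp : p ∈ S)
    (hdeg : 2 ≤ p.natDegree) : ∃ z, ¬ Tame S z := by
  by_contra! hcon
  have hdeg' : (p - X).natDegree = p.natDegree :=
    natDegree_sub_eq_left_of_natDegree_lt (by rw [natDegree_X]; omega)
  obtain ⟨z₀, hz₀⟩ := IsAlgClosed.exists_root (p - X) (by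
    intro h0
    have := natDegree_eq_zero_iff_degree_le_zero.2 h0.le
    omega)
  have hfix : p.eval z₀ = z₀ := by
    have : p.eval z₀ - z₀ = 0 := by simpa [IsRoot.def] using hz₀
    exact sub_eq_zero.1 this
  have hiter : ∀ k : ℕ, wd (List.replicate k p) z₀ = z₀ := fun k => by
    induction k with
    | zero => simp
    | succ k ih => rw [List.replicate_succ, wd_cons, ih, hfix]
  set R₁ := max R ‖z₀‖ with hR₁
  have hbd := norm_orbit_le_of_isPreconnected hE (le_max_left R ‖z₀‖) isPreconnected_univ
    (fun z _ => hcon z) (b := fun _ => [p]) (L := fun k => List.replicate k p) (by simpa using hp)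
    (by simp) (fun k q hq => by rw [List.eq_of_mem_replicate hq]; exact hp)
    (fun k => by rw [List.replicate_succ]; rfl) (Set.mem_univ z₀)
    (fun k => by rw [hiter]; exact le_max_right _ _)
  have h1 := hbd ((R₁ + 1 : ℝ) : ℂ) (Set.mem_univ _) 0
  have h2 : 0 ≤ R₁ := (norm_nonneg z₀).trans (le_max_right _ _)
  simp only [List.replicate_zero, wd_nil, Complex.norm_real, Real.norm_eq_abs] at h1
  rw [abs_of_nonneg (by linarith)] at h1
  linarith

/-- Lower semicontinuity of the set of non-tame points. The orbit in `J` of a point of `J` is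
shadowed by an orbit of the perturbed family `S'`, because inverse branches of long words contract.
If all the points near by were tame for `S'`, their orbits would all be bounded, against the
expansion along the first block of the orbit. -/
theorem exists_close_not_tame {R : ℝ} {S : Set ℂ[X]} (hE : Escapes R S) (hB : LocBdd S)
    (hH : ∀ z ∈ planarPC S, Tame S z) {J : Set ℂ} (hJ : IsCompact J) (hJR : J ⊆ closedBall 0 R)
    (hJP : Disjoint J (planarPC S)) (hJS : ∀ z ∈ J, ∃ p ∈ S, p.eval z ∈ J) {ε : ℝ} (hε : 0 < ε) :
    ∃ M : ℝ, ∃ η > 0, ∀ S' : Set ℂ[X], Escapes R S' → (∀ p ∈ S, ∃ p' ∈ S', CloseOn M η p p') →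
      ∀ z ∈ J, ∃ z' ∈ ball z ε, ¬ Tame S' z' := by
  wlog hε1 : ε ≤ 1 generalizing ε
  · obtain ⟨M, η, hη, h⟩ := this one_pos le_rfl
    refine ⟨M, η, hη, fun S' h1 h2 z hz => ?_⟩
    obtain ⟨z', hz', h3⟩ := h S' h1 h2 z hz
    exact ⟨z', ball_subset_ball (not_le.1 hε1).le hz', h3⟩
  have hR1 := hE.one_le
  obtain ⟨d, hd, hdJ⟩ := hJ.exists_thickening_subset_open
    (isClosed_closure (s := critOrbit S)).isOpen_compl (Set.disjoint_left.1 hJP)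
  set ρ := min (ε / 2) (d / 8) with hρdef
  have hρ : 0 < ρ := by positivity
  have hρε : ρ ≤ ε / 2 := min_le_left _ _
  have hρd : 8 * ρ ≤ d := by linarith [min_le_right (ε / 2) (d / 8)]
  have hdisj : ∀ y ∈ J, ∀ ζ ∈ ball y (8 * ρ), ζ ∉ planarPC S := fun y hy ζ hζ =>
    hdJ (mem_thickening_iff.2 ⟨y, hy, (mem_ball.1 hζ).trans_le hρd⟩)
  set C := max 4 (2 * (R + 2) / ε + 1) with hC
  have hC4 : 4 ≤ C := le_max_left _ _
  obtain ⟨n₀, hn₀⟩ := exists_le_norm_deriv hE hH (R + 2) (show 0 < 4 * ρ by positivity)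
    (show 0 < C by linarith)
  set n := max n₀ 1 with hn
  obtain ⟨M, η, hη, hclose⟩ := hB.exists_norm_wd_sub_wd_le n (R + 2)
    (show 0 < ρ / 4 by positivity)
  refine ⟨M, η, hη, fun S' hE' hS' z hz => ?_⟩
  by_contra! hcon
  -- blocks of length `n` along an orbit that stays in `J`
  have hblock : ∀ m : ℕ, ∀ x ∈ J, ∃ l : List ℂ[X], (∀ p ∈ l, p ∈ S) ∧ l.length = m ∧
      wd l x ∈ J := by
    intro m
    induction m with
    | zero => exact fun x hx => ⟨[], by simp, rfl, by simpa using hx⟩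
    | succ m ih =>
      intro x hx
      obtain ⟨l, hl, hlen, hlx⟩ := ih x hx
      obtain ⟨p, hp, hpx⟩ := hJS _ hlx
      refine ⟨p :: l, fun q hq => ?_, by simp [hlen], by simpa using hpx⟩
      rcases List.mem_cons.1 hq with rfl | h'
      exacts [hp, hl q h']
  have hstep : ∀ x : J, ∃ l l' : List ℂ[X], (∀ p ∈ l, p ∈ S) ∧ (∀ p ∈ l', p ∈ S') ∧
      l.length = n ∧ l'.length = n ∧ wd l x ∈ J ∧
      ∀ w : ℂ, ‖w‖ ≤ R + 2 → ‖wd l w - wd l' w‖ ≤ ρ / 4 := by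
    rintro ⟨x, hx⟩
    obtain ⟨l, hl, hlen, hlx⟩ := hblock n x hx
    obtain ⟨l', hl', hll⟩ := exists_forall₂_of_forall_exists fun p hp => hS' p (hl p hp)
    exact ⟨l, l', hl, hl', hlen, hll.length_eq ▸ hlen, hlx, fun w hw =>
      hclose l l' hl hll hlen.le w w hw (by simpa using hη.le)⟩
  choose lw lw' hlS hlS' hllen hllen' hlJ hll using hstep
  -- the inverse branch `h` of the block `lw x` contracts by the factor `4`, and followed by the
  -- perturbed block `lw' x` it is close to the identity
  have hcover : ∀ x : J, closedBall (wd (lw x) x) ρ ⊆ wd (lw' x) '' closedBall (x : ℂ) ρ := by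
    intro x
    set y := wd (lw x) x with hy
    have hyJ : y ∈ J := hlJ x
    have hyR : ‖y‖ ≤ R := mem_closedBall_zero_iff.1 (hJR hyJ)
    have hxR : ‖(x : ℂ)‖ ≤ R := mem_closedBall_zero_iff.1 (hJR x.2)
    have h8 : 0 < 8 * ρ := by positivity
    obtain ⟨h, h1, h2, h3, -⟩ := exists_inverse_branch_wd hE (M := R + 8) (by linarith) (hlS x) h8
      (Set.disjoint_left.2 (hdisj y hyJ)) (by linarith) (mem_ball_self h8)
    have hderiv : ∀ ζ ∈ closedBall y (4 * ρ), ‖deriv h ζ‖ ≤ 1 / 4 := by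
      intro ζ hζ
      rw [mem_closedBall] at hζ
      have hζ8 : ζ ∈ ball y (8 * ρ) := by rw [mem_ball]; linarith
      have h5 := congrArg norm (deriv_inverse_branch_mul h1 h2 hζ8)
      rw [norm_mul, norm_one] at h5
      have h6 := hn₀ (lw x) (hlS x) (by rw [hllen]; exact le_max_left _ _) (h ζ) (by
        rw [h2 ζ hζ8]
        rw [dist_eq_norm] at hζ
        linarith [norm_le_norm_add_norm_sub' ζ y]) (by
        rw [h2 ζ hζ8]
        refine Set.disjoint_left.2 fun w hw => hdisj y hyJ w ?_
        rw [mem_ball] at hw ⊢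
        linarith [dist_triangle w ζ y])
      nlinarith [norm_nonneg (deriv h ζ)]
    have hmaps : ∀ ζ ∈ closedBall y (4 * ρ), h ζ ∈ closedBall (x : ℂ) ρ := by
      intro ζ hζ
      have h7 := (convex_closedBall y (4 * ρ)).norm_image_sub_le_of_norm_deriv_le
        (fun w hw => h1.differentiableAt (isOpen_ball.mem_nhds
          (closedBall_subset_ball (by linarith) hw))) hderiv
        (mem_closedBall_self (by positivity)) hζ
      rw [h3] at h7
      rw [mem_closedBall, dist_eq_norm] at hζ ⊢
      linarith
    have himg := closedBall_subset_image_of_near_id (F := fun ζ => wd (lw' x) (h ζ)) (y := y)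
      (r := 4 * ρ) (r' := 8 * ρ) (by positivity) (by linarith)
      ((differentiable_wd _).comp_differentiableOn h1) (fun ζ hζ => by
        have hζ8 : ζ ∈ ball y (8 * ρ) := closedBall_subset_ball (by linarith) hζ
        have h9 := hmaps ζ hζ
        rw [mem_closedBall, dist_eq_norm] at h9
        have h10 := hll x (h ζ) (by linarith [norm_le_norm_add_norm_sub' (h ζ) (x : ℂ)])
        rw [h2 ζ hζ8, norm_sub_rev] at h10
        linarith)
    intro w hw
    obtain ⟨ζ, hζ, rfl⟩ := himg (by convert hw using 2; ring)
    exact ⟨h ζ, hmaps ζ hζ, rfl⟩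
  let xs : ℕ → J := fun k => Nat.rec ⟨z, hz⟩ (fun _ x => ⟨wd (lw x) x, hlJ x⟩) k
  have hxs : ∀ k, (xs (k + 1)).1 = wd (lw (xs k)) (xs k).1 := fun _ => rfl
  let L : ℕ → List ℂ[X] := fun k => Nat.rec [] (fun k l => lw' (xs k) ++ l) k
  have hLs : ∀ k, L (k + 1) = lw' (xs k) ++ L k := fun k => rfl
  have hL0 : L 0 = [] := rfl
  have hL1 : L 1 = lw' (xs 0) := List.append_nil _
  have hx0 : (xs 0).1 = z := rfl
  have hLS' : ∀ k, ∀ p ∈ L k, p ∈ S' := fun k => by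
    induction k with
    | zero => intro p hp; exact absurd hp List.not_mem_nil
    | succ k ih =>
      intro p hp
      rw [hLs] at hp
      rcases List.mem_append.1 hp with h | h
      exacts [hlS' _ p h, ih p h]
  -- the orbit `xs` of `z` stays in `J`; by pulling back along the perturbed words `L k` it is shadowed
  -- for any finite time, and by compactness for all times
  have hreach : ∀ k : ℕ, ∀ y ∈ closedBall (xs k).1 ρ, ∃ w, wd (L k) w = y ∧
      ∀ j ≤ k, wd (L j) w ∈ closedBall (xs j).1 ρ := by
    intro k
    induction k with
    | zero =>
      intro y hy
      have h0 : wd (L 0) y = y := wd_nil y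
      refine ⟨y, h0, fun j hj => ?_⟩
      obtain rfl := Nat.le_zero.1 hj
      rwa [h0]
    | succ k ih =>
      intro y hy
      have hy0 := hy
      rw [hxs] at hy
      obtain ⟨y', hy', rfl⟩ := hcover (xs k) hy
      obtain ⟨w, hw, hwj⟩ := ih y' hy'
      have hwk : wd (L (k + 1)) w = wd (lw' (xs k)) y' := by rw [hLs, wd_append, hw]
      refine ⟨w, hwk, fun j hj => ?_⟩
      rcases Nat.lt_or_ge k j with h | h
      · obtain rfl : j = k + 1 := by omega
        rw [hwk]; exact hy0
      · exact hwj j h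
  obtain ⟨z', hz'⟩ : ∃ z', ∀ k : ℕ, wd (L k) z' ∈ closedBall (xs k).1 ρ := by
    have hcl : ∀ k, IsClosed {w : ℂ | ∀ j ≤ k, wd (L j) w ∈ closedBall (xs j).1 ρ} := fun k => by
      simp only [Set.ofPred_forall]
      exact isClosed_iInter fun j => isClosed_iInter fun _ =>
        isClosed_closedBall.preimage (differentiable_wd _).continuous
    have hne := IsCompact.nonempty_iInter_of_sequence_nonempty_isCompact_isClosed
      (fun k => {w : ℂ | ∀ j ≤ k, wd (L j) w ∈ closedBall (xs j).1 ρ})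
      (fun k w hw j hj => hw j (hj.trans (Nat.le_succ k)))
      (fun k => by
        obtain ⟨w, -, hw⟩ := hreach k (xs k) (mem_closedBall_self hρ.le)
        exact ⟨w, hw⟩)
      ((isCompact_closedBall (xs 0).1 ρ).of_isClosed_subset (hcl 0) fun w hw => by
        simpa [hL0] using hw 0 le_rfl)
      hcl
    obtain ⟨w, hw⟩ := hne
    exact ⟨w, fun k => Set.mem_iInter.1 hw k k le_rfl⟩
  have hz'D : z' ∈ ball z ε := by
    have := hz' 0
    rw [hL0, wd_nil, hx0, mem_closedBall] at this
    rw [mem_ball]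
    exact this.trans_lt (by linarith)
  have hbd := norm_orbit_le_of_isPreconnected hE' (R₁ := R + 1) (by linarith)
    (convex_ball z ε).isPreconnected hcon (b := fun k => lw' (xs k)) (L := L)
    (fun k => hlS' _) (fun k => by
      rw [← List.length_pos_iff, hllen']; exact lt_of_lt_of_le one_pos (le_max_right _ _))
    hLS' hLs hz'D (fun k => by
      have h1 := hz' k
      rw [mem_closedBall, dist_eq_norm] at h1
      have h2 := mem_closedBall_zero_iff.1 (hJR (xs k).2)
      linarith [norm_le_norm_add_norm_sub' (wd (L k) z') (xs k).1])
  have hzR : ‖z‖ ≤ R := mem_closedBall_zero_iff.1 (hJR hz)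
  have hfirst : ∀ w ∈ ball z ε, ‖wd (lw (xs 0)) w‖ ≤ R + 2 := by
    intro w hw
    have h1 : ‖wd (lw' (xs 0)) w‖ ≤ R + 1 := by
      have := hbd w hw 1
      rwa [hL1] at this
    rw [mem_ball, dist_eq_norm] at hw
    have h2 := hll (xs 0) w (by linarith [norm_le_norm_add_norm_sub' w z])
    linarith [norm_le_norm_add_norm_sub' (wd (lw (xs 0)) w) (wd (lw' (xs 0)) w)]
  have h1 := norm_deriv_le_of_norm_le hε (differentiable_wd _).differentiableOn hfirst
  have h2 := hn₀ (lw (xs 0)) (hlS _) (by rw [hllen]; exact le_max_left _ _) z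
    (hfirst z (mem_ball_self hε)) (Set.disjoint_left.2 fun w hw =>
      hdisj _ (hlJ (xs 0)) w (ball_subset_ball (by linarith) hw))
  linarith [le_max_right 4 (2 * (R + 2) / ε + 1)]

/-! ### Normality on the sphere -/

theorem tendstoLocallyUniformlyOn_of_tendsto_prod {X Y : Type*} [TopologicalSpace X]
    [UniformSpace Y] {F : ℕ → X → Y} {f : X → Y} {U : Set X} (hU : IsOpen U)
    (hf : ∀ x ∈ U, ContinuousAt f x)
    (hF : ∀ x ∈ U, Tendsto (fun y : ℕ × X => F y.1 y.2) (atTop ×ˢ 𝓝 x) (𝓝 (f x))) :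
    TendstoLocallyUniformlyOn F f atTop U := by
  rw [hU.tendstoLocallyUniformlyOn_iff_forall_tendsto]
  intro x hx
  have h1 : Tendsto (fun y : ℕ × X => f y.2) (atTop ×ˢ 𝓝 x) (𝓝 (f x)) :=
    (hf x hx).tendsto.comp tendsto_snd
  exact (h1.prodMk_nhds (hF x hx)).mono_right (nhds_le_uniformity _)

theorem tendsto_prod_of_tendstoUniformlyOn {F : ℕ → ℂ → ℂ} {g : ℂ → ℂ} {B : Set ℂ}
    (h : TendstoUniformlyOn F g atTop B) {z : ℂ} (hB : B ∈ 𝓝 z) (hg : ContinuousAt g z) :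
    Tendsto (fun y : ℕ × ℂ => F y.1 y.2) (atTop ×ˢ 𝓝 z) (𝓝 (g z)) := by
  rw [Metric.tendsto_nhds]
  intro ε hε
  have h1 := Metric.tendstoUniformlyOn_iff.1 h (ε / 2) (half_pos hε)
  have h2 : ∀ᶠ w in 𝓝 z, w ∈ B ∧ dist (g w) (g z) < ε / 2 :=
    (show ∀ᶠ w in 𝓝 z, w ∈ B from hB).and (hg (ball_mem_nhds _ (half_pos hε)))
  filter_upwards [h1.prod_mk h2] with y hy
  have h3 := hy.1 y.2 hy.2.1
  rw [dist_comm] at h3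
  linarith [hy.2.2, dist_triangle (F y.1 y.2) (g y.2) (g z)]

/-- Montel's theorem for maps of the sphere that factor, in fixed coordinates `Φ` and `Ψ`, through
uniformly bounded holomorphic functions on a disc. -/
theorem exists_subseq_of_factors {u : ℕ → Sphere → Sphere} {h : ℕ → ℂ → ℂ} {Φ : ℂ → Sphere}
    {Ψ : Sphere → ℂ} {U : Set Sphere} {q : ℂ} {s M : ℝ} (hs : 0 < s)
    (hh : ∀ k, DifferentiableOn ℂ (h k) (ball q s)) (hM : ∀ k, ∀ z ∈ ball q s, ‖h k z‖ ≤ M)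
    (hU : IsOpen U) (hΦ : Continuous Φ) (hΨ : ∀ x ∈ U, ContinuousAt Ψ x)
    (hmaps : ∀ x ∈ U, Ψ x ∈ ball q (s / 2)) (hu : ∀ k, ∀ x ∈ U, u k x = Φ (h k (Ψ x))) :
    ∃ φ : ℕ → ℕ, StrictMono φ ∧ ∃ f : Sphere → Sphere,
      TendstoLocallyUniformlyOn (fun n => u (φ n)) f atTop U := by
  obtain ⟨φ, hφ, g, hg⟩ := exists_subseq_tendstoUniformlyOn hs hh hM
  have hgc : ContinuousOn g (ball q (s / 2)) := hg.continuousOn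
    (Frequently.of_forall fun k => ((hh _).continuousOn.mono (ball_subset_ball (by linarith))))
  have hgat : ∀ x ∈ U, ContinuousAt g (Ψ x) := fun x hx =>
    hgc.continuousAt (isOpen_ball.mem_nhds (hmaps x hx))
  refine ⟨φ, hφ, fun x => Φ (g (Ψ x)), tendstoLocallyUniformlyOn_of_tendsto_prod hU
    (fun x hx => hΦ.continuousAt.comp ((hgat x hx).comp (hΨ x hx))) fun x hx => ?_⟩
  have h1 := tendsto_prod_of_tendstoUniformlyOn hg (isOpen_ball.mem_nhds (hmaps x hx)) (hgat x hx)
  have h2 : Tendsto (fun y : ℕ × Sphere => (y.1, Ψ y.2)) (atTop ×ˢ 𝓝 x) (atTop ×ˢ 𝓝 (Ψ x)) :=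
    tendsto_id.prodMap (hΨ x hx)
  have h3 := (hΦ.continuousAt (x := g (Ψ x))).tendsto.comp (h1.comp h2)
  refine h3.congr' ?_
  filter_upwards [tendsto_snd.eventually (hU.mem_nhds hx)] with y hy
  exact (hu (φ y.1) y.2 hy).symm

/-- The coordinate `ζ ↦ a + 1 / ζ` of the sphere, sending `0` to `∞`. -/
def invCoord (a ζ : ℂ) : Sphere := if ζ = 0 then ∞ else ((a + ζ⁻¹ : ℂ) : Sphere)

theorem continuous_invCoord (a : ℂ) : Continuous (invCoord a) := by
  rw [continuous_iff_continuousAt]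
  intro ζ
  by_cases hζ : ζ = 0
  · subst hζ
    rw [continuousAt_iff_punctured_nhds]
    have h0 : invCoord a 0 = ∞ := by simp [invCoord]
    rw [h0]
    have h1 : Tendsto (fun ζ : ℂ => a + ζ⁻¹) (𝓝[≠] 0) (coclosedCompact ℂ) := by
      rw [coclosedCompact_eq_cocompact, ← Metric.cobounded_eq_cocompact]
      exact tendsto_const_add_cobounded a |>.comp tendsto_inv₀_nhdsNE_zero
    refine (OnePoint.tendsto_coe_infty.comp h1).congr' ?_
    filter_upwards [self_mem_nhdsWithin] with w hw
    simp only [invCoord, Function.comp_apply, if_neg (show ¬ w = 0 from hw)]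
  · have h1 : ContinuousAt (fun ζ : ℂ => ((a + ζ⁻¹ : ℂ) : Sphere)) ζ :=
      OnePoint.continuous_coe.continuousAt.comp (continuousAt_const.add (continuousAt_inv₀ hζ))
    refine h1.congr ?_
    filter_upwards [isOpen_ne.mem_nhds hζ] with w hw
    simp only [invCoord, if_neg (show ¬ w = 0 from hw)]

theorem toMap_coe (g : Poly) (z : ℂ) : g.toMap (z : Sphere) = ((g.1.eval z : ℂ) : Sphere) := rfl

theorem toMap_infty (g : Poly) : g.toMap ∞ = ∞ := rfl

/-- Sequences of polynomials omitting a fixed disc are normal: take `1 / (w - a)` as the coordinate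
on the target. -/
theorem exists_subseq_of_omits_disc {g : ℕ → Poly} {q a : ℂ} {s r : ℝ} (hs : 0 < s) (hr : 0 < r)
    (h : ∀ k, ∀ z ∈ ball q s, r ≤ ‖(g k).1.eval z - a‖) :
    ∃ φ : ℕ → ℕ, StrictMono φ ∧ ∃ f : Sphere → Sphere,
      TendstoLocallyUniformlyOn (fun n => (g (φ n)).toMap) f atTop
        ((↑) '' ball q (s / 2) : Set Sphere) := by
  have hne : ∀ k, ∀ z ∈ ball q s, (g k).1.eval z - a ≠ 0 := fun k z hz h0 => by
    have := h k z hz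
    rw [h0, norm_zero] at this
    linarith
  refine exists_subseq_of_factors (u := fun k => (g k).toMap)
    (h := fun k z => ((g k).1.eval z - a)⁻¹) (Φ := invCoord a)
    (Ψ := fun x => x.elim 0 id) (q := q) (s := s) (M := r⁻¹) hs (fun k => ?_) (fun k z hz => ?_)
    (OnePoint.isOpen_image_coe.2 isOpen_ball) (continuous_invCoord a) ?_ ?_ ?_
  · exact ((g k).1.differentiable.sub_const a).differentiableOn.inv (hne k)
  · rw [norm_inv]
    exact inv_anti₀ hr (h k z hz)
  · rintro _ ⟨z, -, rfl⟩
    rw [OnePoint.continuousAt_coe]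
    exact continuousAt_id
  · rintro _ ⟨z, hz, rfl⟩
    exact hz
  · rintro k _ ⟨z, hz, rfl⟩
    have h0 := hne k z (ball_subset_ball (by linarith) hz)
    simp only [OnePoint.elim_some, id, toMap_coe, invCoord, if_neg (inv_ne_zero h0), inv_inv,
      add_sub_cancel]

/-- A point of the plane belongs to the Fatou set if on a disc around it each element of the
semigroup either avoids a fixed disc or is bounded by a fixed constant. -/
theorem coe_mem_fatou {G : Subsemigroup Poly} {q a : ℂ} {s r M : ℝ} (hs : 0 < s) (hr : 0 < r)
    (h : ∀ g ∈ G, (∀ z ∈ ball q s, r ≤ ‖g.1.eval z - a‖) ∨ (∀ z ∈ ball q s, ‖g.1.eval z‖ ≤ M)) :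
    (q : Sphere) ∈ fatou G := by
  refine ⟨(↑) '' ball q (s / 2), OnePoint.isOpen_image_coe.2 isOpen_ball,
    ⟨q, mem_ball_self (half_pos hs), rfl⟩, fun u hu => ?_⟩
  choose g hgG hgu using hu
  have key : ∀ (a' : ℂ) (r' : ℝ), 0 < r' →
      (∃ᶠ n in atTop, ∀ z ∈ ball q s, r' ≤ ‖(g n).1.eval z - a'‖) →
      ∃ φ : ℕ → ℕ, StrictMono φ ∧ ∃ f : Sphere → Sphere,
        TendstoLocallyUniformlyOn (fun n => u (φ n)) f atTop
          ((↑) '' ball q (s / 2) : Set Sphere) := by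
    intro a' r' hr' hfr
    obtain ⟨ψ, hψ, hψ'⟩ := extraction_of_frequently_atTop hfr
    obtain ⟨φ, hφ, f, hf⟩ := exists_subseq_of_omits_disc (g := fun k => g (ψ k)) hs hr' hψ'
    refine ⟨ψ ∘ φ, hψ.comp hφ, f, ?_⟩
    simpa only [Function.comp_apply, hgu] using hf
  by_cases hfr : ∃ᶠ n in atTop, ∀ z ∈ ball q s, r ≤ ‖(g n).1.eval z - a‖
  · exact key a r hr hfr
  · rw [not_frequently] at hfr
    -- bounded functions avoid the unit disc centred outside the disc of radius `M`
    refine key ((|M| + 1 : ℝ) : ℂ) 1 one_pos (Eventually.frequently ?_)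
    filter_upwards [hfr] with n hn z hz
    have h1 := ((h (g n) (hgG n)).resolve_left hn) z hz
    have h2 := norm_sub_norm_le (((|M| + 1 : ℝ) : ℂ)) ((g n).1.eval z)
    rw [norm_sub_rev, Complex.norm_real, Real.norm_eq_abs, abs_of_nonneg (by positivity)] at h2
    linarith [le_abs_self M]

/-- If the elements of `G` do not decrease large moduli, then they are bounded in the coordinate
`1 / z` near `∞`. -/
theorem infty_mem_fatou {G : Subsemigroup Poly} {R : ℝ} (hR : 0 < R)
    (h : ∀ g ∈ G, ∀ z : ℂ, R ≤ ‖z‖ → ‖z‖ ≤ ‖g.1.eval z‖) : ∞ ∈ fatou G := by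
  refine ⟨((↑) '' closedBall (0 : ℂ) (2 * R))ᶜ, OnePoint.isOpen_compl_image_coe.2
    ⟨isClosed_closedBall, isCompact_closedBall _ _⟩, fun ⟨z, _, hz⟩ => OnePoint.coe_ne_infty z hz,
    fun u hu => ?_⟩
  choose g hgG hgu using hu
  set hk : ℕ → ℂ → ℂ := fun k ζ => if ζ = 0 then 0 else ((g k).1.eval ζ⁻¹)⁻¹ with hhk
  have hbound : ∀ k, ∀ ζ ∈ ball (0 : ℂ) R⁻¹, ‖hk k ζ‖ ≤ ‖ζ‖ := by
    intro k ζ hζ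
    by_cases h0 : ζ = 0
    · simp [hhk, h0]
    · have hpos : 0 < ‖ζ‖ := norm_pos_iff.2 h0
      have h1 : R ≤ ‖ζ⁻¹‖ := by
        rw [mem_ball_zero_iff] at hζ
        rw [norm_inv, le_inv_comm₀ hR hpos]
        exact hζ.le
      have h2 := h (g k) (hgG k) ζ⁻¹ h1
      simp only [hhk, if_neg h0, norm_inv]
      rw [norm_inv] at h2
      exact inv_le_of_inv_le₀ hpos h2
  have hne : ∀ k, ∀ ζ ∈ ball (0 : ℂ) R⁻¹, ζ ≠ 0 → (g k).1.eval ζ⁻¹ ≠ 0 := by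
    intro k ζ hζ h0 hz
    have hpos : 0 < ‖ζ‖ := norm_pos_iff.2 h0
    have h1 : R ≤ ‖ζ⁻¹‖ := by
      rw [mem_ball_zero_iff] at hζ
      rw [norm_inv, le_inv_comm₀ hR hpos]
      exact hζ.le
    have h2 := h (g k) (hgG k) ζ⁻¹ h1
    rw [hz, norm_zero] at h2
    linarith
  refine exists_subseq_of_factors (h := hk) (Φ := invCoord 0)
    (Ψ := fun x => x.elim 0 fun z => z⁻¹) (q := 0) (s := R⁻¹) (M := R⁻¹) (inv_pos.2 hR)
    (fun k => ?_) (fun k z hz => ?_) (OnePoint.isOpen_compl_image_coe.2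
      ⟨isClosed_closedBall, isCompact_closedBall _ _⟩) (continuous_invCoord 0) ?_ ?_ ?_
  · refine (Complex.differentiableOn_compl_singleton_and_continuousAt_iff
      (ball_mem_nhds (0 : ℂ) (inv_pos.2 hR))).1 ⟨?_, ?_⟩
    · have h1 : DifferentiableOn ℂ (fun ζ : ℂ => ((g k).1.eval ζ⁻¹)⁻¹) (ball 0 R⁻¹ \ {0}) :=
        DifferentiableOn.inv ((g k).1.differentiable.comp_differentiableOn
          (differentiableOn_inv.mono fun z hz => hz.2)) fun ζ hζ => hne k ζ hζ.1 hζ.2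
      refine h1.congr fun ζ hζ => ?_
      simp only [hhk, if_neg (show ¬ ζ = 0 from hζ.2)]
    · have h0 : hk k 0 = 0 := by simp [hhk]
      rw [ContinuousAt, h0]
      refine squeeze_zero_norm' ?_ (continuous_norm.tendsto' (0 : ℂ) 0 norm_zero)
      filter_upwards [ball_mem_nhds (0 : ℂ) (inv_pos.2 hR)] with ζ hζ using hbound k ζ hζ
  · exact (hbound k z hz).trans (mem_ball_zero_iff.1 hz).le
  · intro x hx
    induction x using OnePoint.rec with
    | infty =>
      rw [OnePoint.continuousAt_infty']
      simp only [OnePoint.elim_infty]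
      rw [coclosedCompact_eq_cocompact, ← Metric.cobounded_eq_cocompact]
      exact tendsto_inv₀_cobounded
    | coe z =>
      rw [OnePoint.continuousAt_coe]
      refine continuousAt_inv₀ fun h0 => hx ⟨z, ?_, rfl⟩
      rw [h0]
      exact mem_closedBall_self (by linarith)
  · intro x hx
    induction x using OnePoint.rec with
    | infty => exact mem_ball_self (by positivity)
    | coe z =>
      have h1 : 2 * R < ‖z‖ := by
        by_contra! hle
        exact hx ⟨z, mem_closedBall_zero_iff.2 hle, rfl⟩
      simp only [OnePoint.elim_some, mem_ball_zero_iff, norm_inv]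
      have : R⁻¹ / 2 = (2 * R)⁻¹ := by rw [mul_inv]; ring
      rw [this]
      exact inv_strictAnti₀ (by linarith) h1
  · intro k x hx
    rw [← hgu]
    induction x using OnePoint.rec with
    | infty => simp [toMap_infty, hhk, invCoord]
    | coe z =>
      have h1 : 2 * R < ‖z‖ := by
        by_contra! hle
        exact hx ⟨z, mem_closedBall_zero_iff.2 hle, rfl⟩
      have hz0 : z⁻¹ ≠ 0 := inv_ne_zero (norm_pos_iff.1 (by linarith))
      have hp0 : (g k).1.eval z ≠ 0 := fun h0 => by
        have h2 := h (g k) (hgG k) z (by linarith)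
        rw [h0, norm_zero] at h2
        linarith
      simp only [OnePoint.elim_some, toMap_coe, hhk, if_neg hz0, inv_inv, invCoord,
        if_neg (inv_ne_zero hp0), zero_add]

theorem isOpen_fatou (G : Subsemigroup Poly) : IsOpen (fatou G) := by
  rw [isOpen_iff_mem_nhds]
  rintro z ⟨U, hU, hz, hn⟩
  exact mem_of_superset (hU.mem_nhds hz) fun w hw => ⟨U, hU, hw, hn⟩

/-! ### The planar description of the semigroup generated by a family -/

/-- The polynomials of a family, as a subset of `ℂ[X]`. -/
def letters (Γ : Omega) : Set ℂ[X] := {p | ∃ g ∈ Γ, g.1.1 = p}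

theorem natDegree_comps {Γ : Omega} {l : List ℂ[X]} (hl : ∀ p ∈ l, p ∈ letters Γ) :
    1 ≤ (comps l).natDegree := by
  induction l with
  | nil => simp [comps]
  | cons p l ih =>
    have h1 := ih fun q hq => hl q (List.mem_cons_of_mem _ hq)
    obtain ⟨g, -, hg⟩ := hl p List.mem_cons_self
    have h2 : 1 ≤ p.natDegree := hg ▸ g.1.2
    change 1 ≤ (p.comp (comps l)).natDegree
    rw [natDegree_comp]
    exact Nat.mul_pos h2 h1

theorem comps_append (l₁ l₂ : List ℂ[X]) : comps (l₁ ++ l₂) = (comps l₁).comp (comps l₂) :=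
  Polynomial.funext fun z => by
    rw [eval_comp]; exact wd_append l₁ l₂ z

theorem exists_word_of_mem_generated {Γ : Omega} {g : Poly} (hg : g ∈ generated Γ) :
    ∃ l : List ℂ[X], l ≠ [] ∧ (∀ p ∈ l, p ∈ letters Γ) ∧ g.1 = comps l := by
  refine Subsemigroup.closure_induction
    (p := fun g _ => ∃ l : List ℂ[X], l ≠ [] ∧ (∀ p ∈ l, p ∈ letters Γ) ∧ g.1 = comps l)
    ?_ ?_ hg
  · rintro _ ⟨g, hg, rfl⟩
    exact ⟨[g.1.1], by simp, by simpa using ⟨g, hg, rfl⟩, by simp [comps]⟩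
  · rintro g h - - ⟨l₁, h1, hl₁, e1⟩ ⟨l₂, -, hl₂, e2⟩
    refine ⟨l₁ ++ l₂, by simp [h1], fun p hp => ?_, ?_⟩
    · rcases List.mem_append.1 hp with h | h
      exacts [hl₁ p h, hl₂ p h]
    · rw [comps_append, ← e1, ← e2]
      rfl

theorem mem_generated_of_word {Γ : Omega} {l : List ℂ[X]} (hl : ∀ p ∈ l, p ∈ letters Γ)
    (h0 : l ≠ []) {g : Poly} (hg : g.1 = comps l) : g ∈ generated Γ := by
  induction l generalizing g with
  | nil => exact absurd rfl h0
  | cons p l ih =>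
    have hl' : ∀ q ∈ l, q ∈ letters Γ := fun q hq => hl q (List.mem_cons_of_mem _ hq)
    obtain ⟨f, hf, rfl⟩ := hl p List.mem_cons_self
    have hfG : f.1 ∈ generated Γ := Subsemigroup.subset_closure ⟨f, hf, rfl⟩
    by_cases hl0 : l = []
    · subst hl0
      have : g = f.1 := Subtype.ext (by rw [hg]; simp [comps])
      rwa [this]
    · have h2 := ih hl' hl0 (g := ⟨comps l, natDegree_comps hl'⟩) rfl
      have : g = f.1 * ⟨comps l, natDegree_comps hl'⟩ := Subtype.ext (by rw [hg]; rfl)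
      rw [this]
      exact (generated Γ).mul_mem hfG h2

theorem exists_mem_generated_of_word {Γ : Omega} {l : List ℂ[X]} (hl : ∀ p ∈ l, p ∈ letters Γ)
    (h0 : l ≠ []) : ∃ g ∈ generated Γ, g.1 = comps l :=
  ⟨⟨comps l, natDegree_comps hl⟩, mem_generated_of_word hl h0 rfl, rfl⟩

/-- A point of the plane is in the Fatou set if near it every nonempty word avoids a fixed disc
or is bounded by a fixed constant. -/
theorem coe_mem_fatou_of_words {Γ : Omega} {q a : ℂ} {s r M : ℝ} (hs : 0 < s) (hr : 0 < r)
    (h : ∀ l : List ℂ[X], l ≠ [] → (∀ p ∈ l, p ∈ letters Γ) →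
      (∀ z ∈ ball q s, r ≤ ‖wd l z - a‖) ∨ (∀ z ∈ ball q s, ‖wd l z‖ ≤ M)) :
    (q : Sphere) ∈ fatou (generated Γ) := by
  refine coe_mem_fatou hs hr (a := a) (M := M) fun g hg => ?_
  obtain ⟨l, h0, hl, e⟩ := exists_word_of_mem_generated hg
  rw [e]
  exact h l h0 hl

/-- If tameness fails at `q`, some elements of the semigroup take values of modulus below `R` and above
`2 * R` at points arbitrarily close to `q`; a locally uniform limit would have a value at `q`
subject to both constraints. -/
theorem tame_of_coe_mem_fatou {Γ : Omega} {q : ℂ} (hq : (q : Sphere) ∈ fatou (generated Γ)) :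
    Tame (letters Γ) q := by
  intro R hR
  by_contra hcon
  obtain ⟨U, hU, hqU, hn⟩ := hq
  -- a radius below which the identity map takes only values of one of the two kinds
  obtain ⟨s₀, hs₀, hid⟩ : ∃ s₀ > 0, (∀ w ∈ ball q s₀, ‖w‖ ≤ 2 * R) ∨ (∀ w ∈ ball q s₀, R ≤ ‖w‖) := by
    have hc : ContinuousAt (fun w : ℂ => ‖w‖) q := continuous_norm.continuousAt
    rcases lt_or_ge ‖q‖ (2 * R) with h | h
    · obtain ⟨s, hs, hsb⟩ := Metric.eventually_nhds_iff_ball.1 (hc.eventually_lt_const h)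
      exact ⟨s, hs, Or.inl fun w hw => (hsb w hw).le⟩
    · obtain ⟨s, hs, hsb⟩ := Metric.eventually_nhds_iff_ball.1
        (hc.eventually_const_lt (show R < ‖q‖ by linarith))
      exact ⟨s, hs, Or.inr fun w hw => (hsb w hw).le⟩
  have hex : ∀ k : ℕ, ∃ g ∈ generated Γ, ∃ a ∈ ball q (s₀ / ((k : ℝ) + 1)),
      ∃ b ∈ ball q (s₀ / ((k : ℝ) + 1)), 2 * R < ‖g.1.eval a‖ ∧ ‖g.1.eval b‖ < R := by
    intro k
    have hpos : 0 < s₀ / ((k : ℝ) + 1) := by positivity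
    have hle : s₀ / ((k : ℝ) + 1) ≤ s₀ := div_le_self hs₀.le (by
      have : (0 : ℝ) ≤ k := k.cast_nonneg
      linarith)
    have h1 : ¬ ∀ l : List ℂ[X], (∀ p ∈ l, p ∈ letters Γ) →
        (∀ w ∈ ball q (s₀ / ((k : ℝ) + 1)), ‖wd l w‖ ≤ 2 * R) ∨
        (∀ w ∈ ball q (s₀ / ((k : ℝ) + 1)), R ≤ ‖wd l w‖) := fun h => hcon ⟨_, hpos, h⟩
    push Not at h1
    obtain ⟨l, hl, ⟨a, ha, ha'⟩, b, hb, hb'⟩ := h1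
    have hl0 : l ≠ [] := by
      rintro rfl
      rw [wd_nil] at ha' hb'
      rcases hid with h | h
      · linarith [h a (ball_subset_ball hle ha)]
      · linarith [h b (ball_subset_ball hle hb)]
    obtain ⟨g, hg, e⟩ := exists_mem_generated_of_word hl hl0
    exact ⟨g, hg, a, ha, b, hb, by rw [e]; exact ha', by rw [e]; exact hb'⟩
  choose g hgG a ha b hb hga hgb using hex
  obtain ⟨φ, hφ, f, hf⟩ := hn (fun k => (g k).toMap) (fun k => ⟨g k, hgG k, rfl⟩)
  have hfc : ContinuousOn f U := hf.continuousOn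
    (Frequently.of_forall fun k => (g (φ k)).continuous_toMap.continuousOn)
  have hrad : Tendsto (fun k : ℕ => s₀ / ((φ k : ℝ) + 1)) atTop (𝓝 0) := by
    have h1 : Tendsto (fun k : ℕ => s₀ * (1 / ((φ k : ℝ) + 1))) atTop (𝓝 (s₀ * 0)) :=
      (tendsto_one_div_add_atTop_nhds_zero_nat.comp hφ.tendsto_atTop).const_mul s₀
    simpa only [mul_one_div, mul_zero] using h1
  have hlim : ∀ c : ℕ → ℂ, (∀ k : ℕ, c k ∈ ball q (s₀ / ((k : ℝ) + 1))) →
      Tendsto (fun k => (((g (φ k)).1.eval (c (φ k)) : ℂ) : Sphere)) atTop (𝓝 (f q)) := by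
    intro c hc
    have h1 : Tendsto (fun k => c (φ k)) atTop (𝓝 q) := by
      rw [tendsto_iff_dist_tendsto_zero]
      exact squeeze_zero (fun _ => dist_nonneg) (fun k => (mem_ball.1 (hc (φ k))).le) hrad
    have h2 : Tendsto (fun k => ((c (φ k) : ℂ) : Sphere)) atTop (𝓝[U] (q : Sphere)) := by
      rw [hU.nhdsWithin_eq hqU]
      exact (OnePoint.continuous_coe.tendsto q).comp h1
    exact hf.tendsto_comp (hfc _ hqU) hqU h2
  have hmem1 : f q ∈ ((↑) '' closedBall (0 : ℂ) R : Set Sphere) := by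
    refine IsClosed.mem_of_tendsto (OnePoint.isClosed_image_coe.2
      ⟨isClosed_closedBall, isCompact_closedBall _ _⟩) (hlim b hb) (Eventually.of_forall fun k => ?_)
    exact ⟨_, mem_closedBall_zero_iff.2 (hgb (φ k)).le, rfl⟩
  have hmem2 : f q ∈ ((↑) '' ball (0 : ℂ) (2 * R) : Set Sphere)ᶜ := by
    refine IsClosed.mem_of_tendsto (OnePoint.isOpen_image_coe.2 isOpen_ball).isClosed_compl
      (hlim a ha) (Eventually.of_forall fun k => ?_)
    rintro ⟨w, hw, hwe⟩
    rw [OnePoint.coe_eq_coe] at hwe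
    rw [hwe, mem_ball_zero_iff] at hw
    linarith [hga (φ k)]
  obtain ⟨w, hw, hwe⟩ := hmem1
  exact hmem2 ⟨w, closedBall_subset_ball (by linarith) hw, hwe⟩

theorem coe_mem_fatou_of_tame {Γ : Omega} {q : ℂ} (hq : Tame (letters Γ) q) :
    (q : Sphere) ∈ fatou (generated Γ) := by
  obtain ⟨s, hs, hsd⟩ := hq 1 one_pos
  refine coe_mem_fatou_of_words hs one_pos (a := 0) (M := 2 * 1) fun l _ hl => ?_
  rcases hsd l hl with h | h
  · exact Or.inr h
  · exact Or.inl fun z hz => by simpa using h z hz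

theorem coe_mem_postcritical_iff {Γ : Omega} {z : ℂ} :
    (z : Sphere) ∈ postcritical (generated Γ) ↔ z ∈ planarPC (letters Γ) := by
  have h1 := OnePoint.isOpenMap_coe.preimage_closure_eq_closure_preimage OnePoint.continuous_coe
    (⋃ g ∈ generated Γ, criticalValues g)
  have h2 : ((↑) : ℂ → Sphere) ⁻¹' (⋃ g ∈ generated Γ, criticalValues g) =
      critOrbit (letters Γ) := by
    ext w
    simp only [Set.mem_preimage, Set.mem_iUnion]
    constructor
    · rintro ⟨g, hg, x, hx, hxw⟩
      obtain ⟨l, -, hl, e⟩ := exists_word_of_mem_generated hg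
      rcases hx with ⟨rfl, -⟩ | ⟨c, rfl, hc⟩
      · exact absurd hxw (OnePoint.infty_ne_coe w)
      · rw [toMap_coe, OnePoint.coe_eq_coe, e] at hxw
        rw [e] at hc
        rw [← hxw]
        exact wd_mem_critOrbit_of_deriv_eq_zero hl hc
    · rintro ⟨l, hl, p, hp, c, hc, rfl⟩
      have hl' : ∀ q ∈ l ++ [p], q ∈ letters Γ := fun q hq => by
        rcases List.mem_append.1 hq with h | h
        · exact hl q h
        · rw [List.mem_singleton.1 h]; exact hp
      obtain ⟨g, hg, e⟩ := exists_mem_generated_of_word hl' (by simp)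
      refine ⟨g, hg, (c : Sphere), Or.inr ⟨c, rfl, ?_⟩, ?_⟩
      · have hcp : comps [p] = p := by simp [comps]
        rw [e, comps_append, hcp, derivative_comp, eval_mul, hc, zero_mul]
      · rw [toMap_coe, OnePoint.coe_eq_coe, e]
        change wd (l ++ [p]) c = _
        rw [wd_append, wd_cons, wd_nil]
  rw [planarPC, ← h2, ← h1]
  rfl

/-! ### Polynomials close in the spherical metric -/

theorem continuous_toMap_prod : Continuous fun y : PolyDegGeTwo × Sphere => y.1.1.toMap y.2 := by
  have h1 : Continuous Poly.toContinuousMap := continuous_induced_dom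
  have h2 : Continuous fun y : PolyDegGeTwo × Sphere => (y.1.1.toContinuousMap, y.2) :=
    (h1.comp (continuous_subtype_val.comp continuous_fst)).prodMk continuous_snd
  exact continuous_eval.comp h2

/-- The value of a polynomial depends jointly continuously on the polynomial and the point. -/
theorem continuous_eval_prod : Continuous fun y : PolyDegGeTwo × ℂ => y.1.1.1.eval y.2 := by
  rw [OnePoint.isOpenEmbedding_coe.isEmbedding.continuous_iff]
  exact continuous_toMap_prod.comp
    (continuous_fst.prodMk (OnePoint.continuous_coe.comp continuous_snd))

theorem eventually_closeOn (p₀ : PolyDegGeTwo) (M : ℝ) {η : ℝ} (hη : 0 < η) :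
    ∀ᶠ p : PolyDegGeTwo in 𝓝 p₀, CloseOn M η p₀.1.1 p.1.1 := by
  have h1 := (isCompact_closedBall (0 : ℂ) M).eventually_forall_of_forall_eventually
    (x₀ := p₀) (P := fun p z => ‖p₀.1.1.eval z - p.1.1.eval z‖ < η) (fun z _ => by
      have h2 : Continuous fun y : PolyDegGeTwo × ℂ => ‖p₀.1.1.eval y.2 - y.1.1.1.eval y.2‖ :=
        ((p₀.1.1.continuous.comp continuous_snd).sub continuous_eval_prod).norm
      refine (h2.tendsto (p₀, z)).eventually_lt_const ?_
      simpa using hη)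
  filter_upwards [h1] with p hp z hz
  exact (hp z (mem_closedBall_zero_iff.2 hz)).le

theorem locBdd_letters (Γ : Omega) : LocBdd (letters Γ) := by
  intro M
  obtain ⟨B, hB⟩ := (((Γ.isCompact.prod (isCompact_closedBall (0 : ℂ) M)).image
    continuous_eval_prod).isBounded).exists_norm_le
  refine ⟨B, ?_⟩
  rintro _ ⟨g, hg, rfl⟩ z hz
  exact hB _ ⟨(g, z), ⟨hg, mem_closedBall_zero_iff.2 hz⟩, rfl⟩

theorem pow_card_mul_prod_le {R t : ℝ} (ht : 0 ≤ t) {z w : ℂ} (s : Multiset ℂ)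
    (hs : ∀ r ∈ s, ‖r‖ ≤ R) (h : ∀ r : ℂ, ‖r‖ ≤ R → t * ‖w - r‖ ≤ ‖z - r‖) :
    t ^ Multiset.card s * ‖(s.map fun r => w - r).prod‖ ≤ ‖(s.map fun r => z - r).prod‖ := by
  induction s using Multiset.induction with
  | empty => simp
  | cons r s ih =>
    have h1 := ih fun r hr => hs r (Multiset.mem_cons_of_mem hr)
    have h2 := h r (hs r (Multiset.mem_cons_self r s))
    rw [Multiset.card_cons, Multiset.map_cons, Multiset.map_cons, Multiset.prod_cons,
      Multiset.prod_cons, norm_mul, norm_mul, pow_succ]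
    calc t ^ Multiset.card s * t * (‖w - r‖ * ‖(s.map fun r => w - r).prod‖)
        = (t * ‖w - r‖) * (t ^ Multiset.card s * ‖(s.map fun r => w - r).prod‖) := by ring
      _ ≤ _ := mul_le_mul h2 h1 (by positivity) (norm_nonneg _)

/-- A polynomial of degree at least two and of modulus at least one outside the disc of radius `R`
expands outside the disc of radius `32 * R ^ 2`, as comparison of the linear factors shows. -/
theorem two_mul_norm_le_norm_eval {p : ℂ[X]} (hdeg : 2 ≤ p.natDegree) {R : ℝ} (hR : 1 ≤ R)
    (h : ∀ z : ℂ, R ≤ ‖z‖ → 1 ≤ ‖p.eval z‖) {z : ℂ} (hz : 32 * R ^ 2 ≤ ‖z‖) :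
    2 * ‖z‖ ≤ ‖p.eval z‖ := by
  have hp0 : p ≠ 0 := by rintro rfl; simp at hdeg
  have hroots : ∀ r ∈ p.roots, ‖r‖ ≤ R := fun r hr => by
    by_contra! hlt
    have h1 := h r hlt.le
    rw [(mem_roots hp0).1 hr, norm_zero] at h1
    linarith
  have heval : ∀ w : ℂ, p.eval w = p.leadingCoeff * (p.roots.map fun r => w - r).prod := fun w => by
    conv_lhs => rw [(IsAlgClosed.splits p).eq_prod_roots]
    rw [eval_mul, eval_C, eval_multiset_prod, Multiset.map_map]
    simp
  have hz4 : 4 * R ≤ ‖z‖ := by nlinarith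
  set t : ℝ := ‖z‖ / (4 * R) with ht
  have ht1 : 1 ≤ t := by rw [ht, le_div_iff₀ (by linarith)]; linarith
  have hnw : ‖((2 * R : ℝ) : ℂ)‖ = 2 * R := by
    rw [Complex.norm_real, Real.norm_eq_abs, abs_of_nonneg (by linarith)]
  have hfac : ∀ r : ℂ, ‖r‖ ≤ R → t * ‖((2 * R : ℝ) : ℂ) - r‖ ≤ ‖z - r‖ := fun r hr => by
    have h1 : ‖((2 * R : ℝ) : ℂ) - r‖ ≤ 3 * R := (norm_sub_le _ _).trans (by rw [hnw]; linarith)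
    have h2 := norm_sub_norm_le z r
    have h3 : t * (3 * R) = 3 / 4 * ‖z‖ := by rw [ht]; field_simp
    have h4 := mul_le_mul_of_nonneg_left h1 (by linarith : 0 ≤ t)
    linarith
  have h1 := pow_card_mul_prod_le (by linarith : 0 ≤ t) p.roots hroots hfac
  have h2 : t ^ 2 ≤ t ^ Multiset.card p.roots := by
    refine pow_le_pow_right₀ ht1 ?_
    rwa [← (IsAlgClosed.splits p).natDegree_eq_card_roots]
  have h3 : 1 ≤ ‖p.eval ((2 * R : ℝ) : ℂ)‖ := h _ (by rw [hnw]; linarith)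
  have h4 : t ^ 2 * ‖p.eval ((2 * R : ℝ) : ℂ)‖ ≤ ‖p.eval z‖ := by
    rw [heval, heval z, norm_mul, norm_mul]
    calc t ^ 2 * (‖p.leadingCoeff‖ * ‖(p.roots.map fun r => ((2 * R : ℝ) : ℂ) - r).prod‖)
        = ‖p.leadingCoeff‖ * (t ^ 2 * ‖(p.roots.map fun r => ((2 * R : ℝ) : ℂ) - r).prod‖) := by
          ring
      _ ≤ _ := mul_le_mul_of_nonneg_left ((mul_le_mul_of_nonneg_right h2 (norm_nonneg _)).trans h1)
          (norm_nonneg _)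
  have h5 : 2 * ‖z‖ ≤ t ^ 2 := by
    rw [ht, div_pow, le_div_iff₀ (by positivity)]
    nlinarith [norm_nonneg z]
  nlinarith [sq_nonneg t]

/-- The critical points lie in a disc containing the roots, by the Gauss-Lucas theorem. -/
theorem norm_le_of_derivative_eval_eq_zero {p : ℂ[X]} (hdeg : 2 ≤ p.natDegree) {R : ℝ}
    (h : ∀ z : ℂ, R ≤ ‖z‖ → p.eval z ≠ 0) {c : ℂ} (hc : p.derivative.eval c = 0) : ‖c‖ ≤ R := by
  have hp0 : p ≠ 0 := by rintro rfl; simp at hdeg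
  have hd0 : p.derivative ≠ 0 := fun h0 => by
    have := derivative_eq_zero.1 h0
    omega
  have h1 := rootSet_derivative_subset_convexHull_rootSet
    (natDegree_pos_iff_degree_pos.1 (by omega : 0 < p.natDegree))
    ((mem_rootSet_of_ne hd0).2 (by simpa using hc))
  have h2 : p.rootSet ℂ ⊆ closedBall 0 R := fun r hr => by
    have h3 : p.eval r = 0 := by simpa using (mem_rootSet_of_ne hp0).1 hr
    rw [mem_closedBall_zero_iff]
    by_contra! hlt
    exact h r hlt.le h3
  exact mem_closedBall_zero_iff.1 (convexHull_min h2 (convex_closedBall _ _) h1)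

theorem eventually_letters {Γ : Omega} {U : Set PolyDegGeTwo} (hU : IsOpen U)
    (hΓ : (Γ : Set PolyDegGeTwo) ⊆ U) : ∀ᶠ Γ' : Omega in 𝓝 Γ, (Γ' : Set PolyDegGeTwo) ⊆ U := by
  obtain ⟨δ, hδ, hsub⟩ := Γ.isCompact.exists_thickening_subset_open hU hΓ
  filter_upwards [Metric.ball_mem_nhds Γ hδ] with Γ' hΓ' p hp
  rw [mem_ball, Omega.dist_eq] at hΓ'
  obtain ⟨q, hq, hpq⟩ := exists_dist_lt_of_hausdorffDist_lt hp hΓ'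
    (hausdorffEDist_ne_top_of_nonempty_of_bounded Γ'.nonempty Γ.nonempty Γ'.isCompact.isBounded
      Γ.isCompact.isBounded)
  exact hsub (mem_thickening_iff.2 ⟨q, hq, hpq⟩)

/-- The radius beyond which the families expand, and which bounds their critical points, can be
chosen uniformly on a neighbourhood of a family. -/
theorem exists_eventually_escapes (Γ : Omega) : ∃ R, ∀ᶠ Γ' : Omega in 𝓝 Γ,
    Escapes R (letters Γ') ∧ ∀ p ∈ letters Γ', ∀ c, p.derivative.eval c = 0 → ‖c‖ ≤ R := by
  have hW : IsOpen {y : PolyDegGeTwo × Sphere |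
      y.1.1.toMap y.2 ∈ ((↑) '' closedBall (0 : ℂ) 1 : Set Sphere)ᶜ} :=
    (OnePoint.isOpen_compl_image_coe.2 ⟨isClosed_closedBall, isCompact_closedBall _ _⟩).preimage
      continuous_toMap_prod
  obtain ⟨U, V, hU, hV, hΓU, hV0, hUV⟩ := generalized_tube_lemma Γ.isCompact
    (isCompact_singleton (x := (∞ : Sphere))) hW (by
      rintro ⟨p, x⟩ ⟨-, hx⟩
      obtain rfl : x = ∞ := hx
      rintro ⟨z, -, hz⟩
      exact OnePoint.coe_ne_infty z hz)
  have hV1 : (∞ : Sphere) ∈ V := hV0 rfl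
  obtain ⟨B, hB⟩ := ((OnePoint.isOpen_iff_of_mem hV1).1 hV).2.isBounded.exists_norm_le
  set R₀ := max 1 (B + 1) with hR₀
  have hR₀1 : 1 ≤ R₀ := le_max_left _ _
  refine ⟨32 * R₀ ^ 2, ?_⟩
  filter_upwards [eventually_letters hU hΓU] with Γ' hΓ'
  have hlow : ∀ g ∈ Γ', ∀ z : ℂ, R₀ ≤ ‖z‖ → 1 ≤ ‖g.1.1.eval z‖ := fun g hg z hz => by
    have hzV : (z : Sphere) ∈ V := by
      by_contra hnot
      have := hB z hnot
      linarith [le_max_right 1 (B + 1)]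
    have h1 := hUV (Set.mk_mem_prod (hΓ' hg) hzV)
    by_contra! hlt
    exact h1 ⟨_, mem_closedBall_zero_iff.2 hlt.le, rfl⟩
  refine ⟨⟨by nlinarith, ?_⟩, ?_⟩
  · rintro _ ⟨g, hg, rfl⟩ z hz
    exact two_mul_norm_le_norm_eval g.2 hR₀1 (hlow g hg) hz
  · rintro _ ⟨g, hg, rfl⟩ c hc
    refine (norm_le_of_derivative_eval_eq_zero g.2 (fun z hz h0 => ?_) hc).trans
      (show R₀ ≤ 32 * R₀ ^ 2 by nlinarith)
    have := hlow g hg z hz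
    rw [h0, norm_zero] at this
    linarith

/-- Near a family, the letters of the two families are uniformly close on discs, in both
directions. -/
theorem eventually_closeOn_letters (Γ : Omega) (M : ℝ) {η : ℝ} (hη : 0 < η) :
    ∀ᶠ Γ' : Omega in 𝓝 Γ, (∀ p' ∈ letters Γ', ∃ p ∈ letters Γ, CloseOn M η p' p) ∧
      ∀ p ∈ letters Γ, ∃ p' ∈ letters Γ', CloseOn M η p p' := by
  have hr : ∀ p₀ : PolyDegGeTwo, ∃ r > 0, ∀ p ∈ ball p₀ r, CloseOn M (η / 2) p₀.1.1 p.1.1 :=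
    fun p₀ => Metric.eventually_nhds_iff_ball.1 (eventually_closeOn p₀ M (half_pos hη))
  choose r hr hclose using hr
  obtain ⟨δ, hδ, hδ'⟩ := lebesgue_number_lemma_of_metric Γ.isCompact
    (c := fun p₀ => ball p₀ (r p₀)) (fun _ => isOpen_ball)
    (fun p _ => Set.mem_iUnion.2 ⟨p, mem_ball_self (hr p)⟩)
  have key : ∀ p ∈ Γ, ∀ p' : PolyDegGeTwo, dist p' p < δ → CloseOn M η p.1.1 p'.1.1 := by
    intro p hp p' hpp z hz
    obtain ⟨p₀, hsub⟩ := hδ' p hp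
    have h1 := hclose p₀ p (hsub (mem_ball_self hδ)) z hz
    have h2 := hclose p₀ p' (hsub hpp) z hz
    rw [norm_sub_rev] at h1
    have h3 : p.1.1.eval z - p'.1.1.eval z = (p.1.1.eval z - p₀.1.1.eval z) +
      (p₀.1.1.eval z - p'.1.1.eval z) := by ring
    rw [h3]
    linarith [norm_add_le (p.1.1.eval z - p₀.1.1.eval z) (p₀.1.1.eval z - p'.1.1.eval z)]
  filter_upwards [Metric.ball_mem_nhds Γ hδ] with Γ' hΓ'
  rw [mem_ball, Omega.dist_eq] at hΓ'
  have hfin : hausdorffEDist (Γ' : Set PolyDegGeTwo) Γ ≠ ⊤ :=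
    hausdorffEDist_ne_top_of_nonempty_of_bounded Γ'.nonempty Γ.nonempty Γ'.isCompact.isBounded
      Γ.isCompact.isBounded
  constructor
  · rintro _ ⟨g, hg, rfl⟩
    obtain ⟨q, hq, hgq⟩ := exists_dist_lt_of_hausdorffDist_lt hg hΓ' hfin
    exact ⟨q.1.1, ⟨q, hq, rfl⟩, (key q hq g hgq).symm⟩
  · rintro _ ⟨g, hg, rfl⟩
    obtain ⟨q, hq, hgq⟩ := exists_dist_lt_of_hausdorffDist_lt' hg hΓ' hfin
    exact ⟨q.1.1, ⟨q, hq, rfl⟩, key g hg q hgq⟩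

/-- The critical values of nearby polynomials are close to those of `p₀`: where `p₀` is not close to
one of its critical values, its derivative is bounded below, by compactness. -/
theorem eventually_criticalValue_close (p₀ : PolyDegGeTwo) (R : ℝ) {η : ℝ} (hη : 0 < η) :
    ∀ᶠ p : PolyDegGeTwo in 𝓝 p₀, ∀ c', ‖c'‖ ≤ R → p.1.1.derivative.eval c' = 0 →
      ∃ c, p₀.1.1.derivative.eval c = 0 ∧ ‖p₀.1.1.eval c - p.1.1.eval c'‖ ≤ η := by
  set O : Set ℂ := ⋃ c ∈ {c : ℂ | p₀.1.1.derivative.eval c = 0},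
    {c' | ‖p₀.1.1.eval c - p₀.1.1.eval c'‖ < η / 2} with hO
  have hOo : IsOpen O := isOpen_biUnion fun c _ =>
    isOpen_lt ((continuous_const.sub p₀.1.1.continuous).norm) continuous_const
  have hK : IsCompact (closedBall (0 : ℂ) R \ O) := (isCompact_closedBall _ _).diff hOo
  obtain ⟨m, hm, hmK⟩ : ∃ m > 0, ∀ c' ∈ closedBall (0 : ℂ) R \ O,
      m ≤ ‖p₀.1.1.derivative.eval c'‖ := by
    rcases (closedBall (0 : ℂ) R \ O).eq_empty_or_nonempty with he | hne
    · exact ⟨1, one_pos, fun c' hc' => by rw [he] at hc'; exact absurd hc' (Set.notMem_empty _)⟩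
    · obtain ⟨c₀, hc₀, hmin⟩ := hK.exists_isMinOn hne
        (p₀.1.1.derivative.continuous.norm.continuousOn)
      refine ⟨_, norm_pos_iff.2 fun h0 => hc₀.2 ?_, fun c' hc' => hmin hc'⟩
      exact Set.mem_biUnion (show c₀ ∈ {c : ℂ | p₀.1.1.derivative.eval c = 0} from h0)
        (by simpa using half_pos hη)
  filter_upwards [eventually_closeOn p₀ (R + 1) (half_pos hη),
    eventually_closeOn p₀ (R + 1) (show 0 < m / 4 by positivity)] with p h1 h2 c' hc'R hc'
  have hderiv : ‖p₀.1.1.derivative.eval c'‖ < m := by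
    have h3 := norm_deriv_le_of_norm_le (f := fun z => p₀.1.1.eval z - p.1.1.eval z) (x := c')
      one_pos (p₀.1.1.differentiable.sub p.1.1.differentiable).differentiableOn
      (fun z hz => h2 z (by
        rw [mem_ball, dist_eq_norm] at hz
        linarith [norm_le_norm_add_norm_sub' z c']))
    have h4 : deriv (fun z => p₀.1.1.eval z - p.1.1.eval z) c' = p₀.1.1.derivative.eval c' := by
      have h5 := (p₀.1.1.hasDerivAt c').sub (p.1.1.hasDerivAt c')
      rw [hc', sub_zero] at h5
      exact h5.deriv
    rw [h4] at h3
    linarith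
  have hc'O : c' ∈ O := by
    by_contra hnot
    exact absurd (hmK c' ⟨mem_closedBall_zero_iff.2 hc'R, hnot⟩) (not_le.2 hderiv)
  obtain ⟨c, hc, hcc⟩ := Set.mem_iUnion₂.1 hc'O
  refine ⟨c, hc, ?_⟩
  have h6 := h1 c' (by linarith)
  have hcc' : ‖p₀.1.1.eval c - p₀.1.1.eval c'‖ < η / 2 := hcc
  have h7 : p₀.1.1.eval c - p.1.1.eval c' = (p₀.1.1.eval c - p₀.1.1.eval c') +
    (p₀.1.1.eval c' - p.1.1.eval c') := by ring
  rw [h7]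
  linarith [norm_add_le (p₀.1.1.eval c - p₀.1.1.eval c') (p₀.1.1.eval c' - p.1.1.eval c')]

theorem eventually_criticalValues_letters_close (Γ : Omega) (R : ℝ) {η : ℝ} (hη : 0 < η) :
    ∀ᶠ Γ' : Omega in 𝓝 Γ, ∀ p' ∈ letters Γ', ∀ c', ‖c'‖ ≤ R → p'.derivative.eval c' = 0 →
      ∃ p ∈ letters Γ, ∃ c, p.derivative.eval c = 0 ∧ ‖p.eval c - p'.eval c'‖ ≤ η := by
  have hr : ∀ p₀ : PolyDegGeTwo, ∃ U : Set PolyDegGeTwo, (∀ p ∈ U, ∀ c', ‖c'‖ ≤ R →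
      p.1.1.derivative.eval c' = 0 → ∃ c, p₀.1.1.derivative.eval c = 0 ∧
        ‖p₀.1.1.eval c - p.1.1.eval c'‖ ≤ η) ∧ IsOpen U ∧ p₀ ∈ U :=
    fun p₀ => eventually_nhds_iff.1 (eventually_criticalValue_close p₀ R hη)
  choose U hU hUo hUm using hr
  filter_upwards [eventually_letters (Γ := Γ) (U := ⋃ p₀ ∈ Γ, U p₀)
    (isOpen_biUnion fun p₀ _ => hUo p₀) fun p hp => Set.mem_biUnion hp (hUm p)] with Γ' hΓ'
  rintro _ ⟨g, hg, rfl⟩ c' hc'R hc'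
  obtain ⟨p₀, hp₀, hgU⟩ := Set.mem_iUnion₂.1 (hΓ' hg)
  obtain ⟨c, hc, hcc⟩ := hU p₀ g hgU c' hc'R hc'
  exact ⟨p₀.1.1, ⟨p₀, hp₀, rfl⟩, c, hc, hcc⟩

/-! ### The planar Julia set and its dependence on the family -/

/-- The finite part of the Julia set of the semigroup generated by a family. -/
def planarJulia (Γ : Omega) : Set ℂ := {z | (z : Sphere) ∈ julia (generated Γ)}

theorem exists_escapes (Γ : Omega) : ∃ R, Escapes R (letters Γ) ∧
    ∀ p ∈ letters Γ, ∀ c, p.derivative.eval c = 0 → ‖c‖ ≤ R := by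
  obtain ⟨R, hR⟩ := exists_eventually_escapes Γ
  exact ⟨R, hR.self_of_nhds⟩

theorem notMem_planarJulia_iff {Γ : Omega} {z : ℂ} :
    z ∉ planarJulia Γ ↔ Tame (letters Γ) z := by
  rw [planarJulia, Set.mem_ofPred_eq, julia, Set.notMem_compl_iff]
  exact ⟨tame_of_coe_mem_fatou, coe_mem_fatou_of_tame⟩

theorem infty_mem_fatou_generated (Γ : Omega) : ∞ ∈ fatou (generated Γ) := by
  obtain ⟨R, hE, -⟩ := exists_escapes Γ
  refine infty_mem_fatou (one_pos.trans_le hE.one_le) fun g hg z hz => ?_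
  obtain ⟨l, -, hl, e⟩ := exists_word_of_mem_generated hg
  rw [e]
  exact hE.le_norm_wd hl hz

theorem coe_image_planarJulia (Γ : Omega) :
    ((↑) '' planarJulia Γ : Set Sphere) = julia (generated Γ) := by
  ext x
  constructor
  · rintro ⟨z, hz, rfl⟩
    exact hz
  · intro hx
    induction x using OnePoint.rec with
    | infty => exact absurd (infty_mem_fatou_generated Γ) hx
    | coe z => exact ⟨z, hx, rfl⟩

theorem planarJulia_subset_closedBall {Γ : Omega} {R : ℝ} (hE : Escapes R (letters Γ)) :
    planarJulia Γ ⊆ closedBall 0 R := by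
  intro z hz
  rw [mem_closedBall_zero_iff]
  by_contra! hlt
  refine hz (coe_mem_fatou_of_words (q := z) (sub_pos.2 hlt) (one_pos.trans_le hE.one_le) (a := 0)
    (M := 0) fun l _ hl => Or.inl fun w hw => ?_)
  rw [mem_ball, dist_comm, dist_eq_norm] at hw
  have h1 : R ≤ ‖w‖ := by linarith [norm_le_norm_add_norm_sub' z w]
  rw [sub_zero]
  exact h1.trans (hE.le_norm_wd hl h1)

theorem isCompact_planarJulia (Γ : Omega) : IsCompact (planarJulia Γ) := by
  obtain ⟨R, hE, -⟩ := exists_escapes Γ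
  exact (isCompact_closedBall (0 : ℂ) R).of_isClosed_subset
    ((isOpen_fatou _).isClosed_compl.preimage OnePoint.continuous_coe)
    (planarJulia_subset_closedBall hE)

theorem planarJulia_nonempty (Γ : Omega) : (planarJulia Γ).Nonempty := by
  obtain ⟨R, hE, -⟩ := exists_escapes Γ
  obtain ⟨g, hg⟩ := Γ.nonempty
  obtain ⟨z, hz⟩ := exists_not_tame hE (p := g.1.1) ⟨g, hg, rfl⟩ g.2
  exact ⟨z, not_not.1 (mt notMem_planarJulia_iff.1 hz)⟩

theorem mem_setH_iff {Γ : Omega} :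
    Γ ∈ setH ↔ ∀ z ∈ planarPC (letters Γ), Tame (letters Γ) z := by
  constructor
  · exact fun h z hz => tame_of_coe_mem_fatou (h (coe_mem_postcritical_iff.2 hz))
  · intro h x hx
    induction x using OnePoint.rec with
    | infty => exact infty_mem_fatou_generated Γ
    | coe z => exact coe_mem_fatou_of_tame (h z (coe_mem_postcritical_iff.1 hx))

theorem mem_setB_iff {Γ : Omega} :
    Γ ∈ setB ↔ Bornology.IsBounded (planarPC (letters Γ)) := by
  have h1 : planarPostcritical (generated Γ) = planarPC (letters Γ) :=
    Set.ext fun z => coe_mem_postcritical_iff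
  have h2 : ∀ g ∈ generated Γ, 2 ≤ g.1.natDegree := fun g hg => by
    obtain ⟨l, h0, hl, e⟩ := exists_word_of_mem_generated hg
    rw [e]
    cases l with
    | nil => exact absurd rfl h0
    | cons p l =>
      have h3 := natDegree_comps fun q hq => hl q (List.mem_cons_of_mem _ hq)
      obtain ⟨f, -, rfl⟩ := hl p List.mem_cons_self
      change 2 ≤ (f.1.1.comp (comps l)).natDegree
      rw [natDegree_comp]
      nlinarith [f.2]
  exact ⟨fun h => h1 ▸ h.2, fun h => ⟨h2, h1 ▸ h⟩⟩

/-- The Julia set is covered by its preimages under the letters: a point all of whose images are in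
the Fatou set is in the Fatou set, by compactness of the family. -/
theorem exists_eval_mem_planarJulia {Γ : Omega} {z : ℂ} (hz : z ∈ planarJulia Γ) :
    ∃ p ∈ letters Γ, p.eval z ∈ planarJulia Γ := by
  by_contra! hcon
  have hK : IsCompact ((fun g : PolyDegGeTwo => g.1.1.eval z) '' (Γ : Set PolyDegGeTwo)) :=
    Γ.isCompact.image (continuous_eval_prod.comp (continuous_id.prodMk continuous_const))
  obtain ⟨s, hs, hsd⟩ := exists_uniform_tame (S := letters Γ) (R := 1) hK (by
    rintro _ ⟨g, hg, rfl⟩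
    exact notMem_planarJulia_iff.1 (hcon g.1.1 ⟨g, hg, rfl⟩) 1 one_pos)
  obtain ⟨L, hL0, hL⟩ := (locBdd_letters Γ).exists_lipschitz (‖z‖ + 1)
  set t := min 1 (s / (L + 1)) with ht
  have ht0 : 0 < t := by positivity
  refine hz (coe_mem_fatou_of_words (q := z) ht0 one_pos (a := 0) (M := 2 * 1) fun l hl0 hl => ?_)
  obtain ⟨l', p, rfl⟩ := (List.eq_nil_or_concat' l).resolve_left hl0
  have hp : p ∈ letters Γ := hl p (by simp)
  have hl' : ∀ q ∈ l', q ∈ letters Γ := fun q hq => hl q (by simp [hq])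
  have hmaps : ∀ w ∈ ball z t, p.eval w ∈ ball (p.eval z) s := fun w hw => by
    rw [mem_ball, dist_eq_norm] at hw ⊢
    have h1 : ‖w - z‖ < 1 := hw.trans_le (min_le_left _ _)
    have h2 : ‖w - z‖ < s / (L + 1) := hw.trans_le (min_le_right _ _)
    rw [lt_div_iff₀ (by linarith)] at h2
    have h3 := hL p hp w z (by linarith [norm_le_norm_add_norm_sub' w z]) (by linarith)
    nlinarith [norm_nonneg (w - z)]
  obtain ⟨g, hg, rfl⟩ := hp
  rcases hsd _ ⟨g, hg, rfl⟩ l' hl' with h | h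
  · refine Or.inr fun w hw => ?_
    rw [wd_append, wd_cons, wd_nil]
    exact h _ (hmaps w hw)
  · refine Or.inl fun w hw => ?_
    rw [wd_append, wd_cons, wd_nil, sub_zero]
    exact h _ (hmaps w hw)

/-- Hyperbolicity, and boundedness of the postcritical set in its presence, are open conditions,
and the Julia set is upper semicontinuous at hyperbolic families. -/
theorem eventually_hyperbolic {Γ : Omega} (hΓ : Γ ∈ setH) {ε : ℝ} (hε : 0 < ε) :
    ∀ᶠ Γ' : Omega in 𝓝 Γ, Γ' ∈ setH ∧ (Γ ∈ setB → Γ' ∈ setB) ∧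
      planarJulia Γ' ⊆ thickening ε (planarJulia Γ) := by
  have hH := mem_setH_iff.1 hΓ
  obtain ⟨R, hR⟩ := exists_eventually_escapes Γ
  obtain ⟨hE, hcrit⟩ := hR.self_of_nhds
  have hB := locBdd_letters Γ
  have hR1 := hE.one_le
  obtain ⟨B₀, hB₀⟩ := hB R
  obtain ⟨a, ha⟩ := planarJulia_nonempty Γ
  have haR := mem_closedBall_zero_iff.1 (planarJulia_subset_closedBall hE ha)
  obtain ⟨d, hd, hdJ⟩ := (isCompact_planarJulia Γ).exists_thickening_subset_open
    (isClosed_closure (s := critOrbit (letters Γ))).isOpen_compl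
    fun z hz hzP => notMem_planarJulia_iff.2 (hH z hzP) hz
  have hdist : ∀ z ∈ planarJulia Γ, ∀ p ∈ planarPC (letters Γ), d ≤ dist p z := fun z hz p hp => by
    by_contra! hlt
    exact hdJ (mem_thickening_iff.2 ⟨z, hz, hlt⟩) hp
  -- a radius beyond the Julia set, and also beyond the postcritical set when that is bounded
  obtain ⟨R₁, hRR₁, hR₁B⟩ : ∃ R₁, R + 1 ≤ R₁ ∧
      (Γ ∈ setB → planarPC (letters Γ) ⊆ closedBall 0 R₁) := by
    by_cases hb : Γ ∈ setB
    · obtain ⟨C, hC⟩ := (mem_setB_iff.1 hb).exists_norm_le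
      exact ⟨max (R + 1) C, le_max_left _ _, fun _ z hz =>
        mem_closedBall_zero_iff.2 ((hC z hz).trans (le_max_right _ _))⟩
    · exact ⟨R + 1, le_rfl, fun h => absurd h hb⟩
  set ε' := min ε (d / 2) with hε'
  have hε'0 : 0 < ε' := by positivity
  have hK : IsCompact (closedBall (0 : ℂ) (R₁ + 1) \ thickening (ε' / 2) (planarJulia Γ)) :=
    (isCompact_closedBall _ _).diff isOpen_thickening
  obtain ⟨M, η, hη, n, hclose⟩ := exists_close_attracting hE hB hH (by linarith : R ≤ R₁) hK
    (fun z hz => notMem_planarJulia_iff.1 fun hzJ =>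
      hz.2 (self_subset_thickening (half_pos hε'0) _ hzJ))
    (fun p hp c hc => hB₀ p hp c (hcrit p hp c hc)) (show 0 < d / 4 by positivity)
  filter_upwards [hR, eventually_closeOn_letters Γ M hη,
    eventually_criticalValues_letters_close Γ R hη] with Γ' hR' hc1 hc2
  obtain ⟨hE', hcrit'⟩ := hR'
  obtain ⟨hP', hK', hb'⟩ := hclose (letters Γ') hE' hc1.1
    fun p' hp' c' hc' => hc2 p' hp' c' (hcrit' p' hp' c' hc') hc'
  have hJ' : planarJulia Γ' ⊆ thickening ε' (planarJulia Γ) := by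
    intro z hz
    by_contra hnot
    have hzR := mem_closedBall_zero_iff.1 (planarJulia_subset_closedBall hE' hz)
    have hsub : ∀ w ∈ ball z (min (ε' / 2) 1),
        w ∈ closedBall (0 : ℂ) (R₁ + 1) \ thickening (ε' / 2) (planarJulia Γ) := by
      intro w hw
      have hw1 : dist w z < 1 := (mem_ball.1 hw).trans_le (min_le_right _ _)
      have hw2 : dist w z < ε' / 2 := (mem_ball.1 hw).trans_le (min_le_left _ _)
      constructor
      · rw [dist_eq_norm] at hw1
        rw [mem_closedBall_zero_iff]
        linarith [norm_le_norm_add_norm_sub' w z]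
      · intro hwJ
        obtain ⟨y, hy, hwy⟩ := mem_thickening_iff.1 hwJ
        refine hnot (mem_thickening_iff.2 ⟨y, hy, ?_⟩)
        rw [dist_comm] at hw2
        linarith [dist_triangle z w y]
    obtain ⟨C, hC⟩ := (locBdd_letters Γ').exists_norm_wd_le n (R₁ + 1)
    -- long words send the disc into the attracting set, which misses a disc around `a`
    refine hz (coe_mem_fatou_of_words (q := z) (s := min (ε' / 2) 1) (a := a) (r := min (d / 4) 1)
      (M := C) (by positivity) (by positivity) fun l _ hl => ?_)
    by_cases hlen : n ≤ l.length
    · refine Or.inl fun w hw => ?_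
      rcases hK' l hl hlen w (hsub w hw) with h | h
      · obtain ⟨p, hp, hwp⟩ := mem_thickening_iff.1 h
        refine (min_le_left _ _).trans ?_
        rw [← dist_eq_norm]
        have h1 := hdist a ha p hp
        have h2 := dist_triangle_left p a (wd l w)
        linarith
      · refine (min_le_right _ _).trans ?_
        have h1 : R₁ < ‖wd l w‖ := h
        linarith [norm_le_norm_add_norm_sub' (wd l w) a]
    · exact Or.inr fun w hw => hC l hl (by omega) w (mem_closedBall_zero_iff.1 (hsub w hw).1)
  refine ⟨mem_setH_iff.2 fun q hq => notMem_planarJulia_iff.1 fun hqJ => ?_, fun hb => ?_,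
    hJ'.trans (thickening_mono (min_le_left _ _) _)⟩
  · obtain ⟨y, hy, hqy⟩ := mem_thickening_iff.1 (hJ' hqJ)
    have hqR := mem_closedBall_zero_iff.1 (planarJulia_subset_closedBall hE' hqJ)
    obtain ⟨w, hw, hqw⟩ := Metric.mem_closure_iff.1 hq (min (d / 8) 1) (by positivity)
    have h1 : dist q w < d / 8 := hqw.trans_le (min_le_left _ _)
    have h2 : dist q w < 1 := hqw.trans_le (min_le_right _ _)
    rcases hP' hw with h | h
    · obtain ⟨p, hp, hwp⟩ := mem_thickening_iff.1 h
      have h3 := hdist y hy p hp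
      have h4 := dist_triangle4 p w q y
      rw [dist_comm p w, dist_comm w q] at h4
      have h5 : ε' ≤ d / 2 := min_le_right _ _
      linarith
    · have h3 : R₁ < ‖w‖ := h
      rw [dist_comm, dist_eq_norm] at h2
      linarith [norm_le_norm_add_norm_sub' w q]
  · rw [mem_setB_iff] at hb ⊢
    exact (hb.thickening.subset (hb' (hR₁B (mem_setB_iff.2 hb)))).closure

/-- The Julia set is lower semicontinuous at hyperbolic families. -/
theorem eventually_planarJulia_subset_thickening {Γ : Omega} (hΓ : Γ ∈ setH) {ε : ℝ} (hε : 0 < ε) :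
    ∀ᶠ Γ' : Omega in 𝓝 Γ, planarJulia Γ ⊆ thickening ε (planarJulia Γ') := by
  have hH := mem_setH_iff.1 hΓ
  obtain ⟨R, hR⟩ := exists_eventually_escapes Γ
  obtain ⟨hE, -⟩ := hR.self_of_nhds
  obtain ⟨M, η, hη, hclose⟩ := exists_close_not_tame hE (locBdd_letters Γ) hH
    (isCompact_planarJulia Γ) (planarJulia_subset_closedBall hE)
    (Set.disjoint_right.2 fun z hz => notMem_planarJulia_iff.2 (hH z hz))
    (fun z hz => exists_eval_mem_planarJulia hz) hε
  filter_upwards [hR, eventually_closeOn_letters Γ M hη] with Γ' hR' hc z hz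
  obtain ⟨z', hz', hnt⟩ := hclose (letters Γ') hR'.1 hc.2 z hz
  exact mem_thickening_iff.2 ⟨z', not_not.1 (mt notMem_planarJulia_iff.1 hnt), by
    rwa [dist_comm]⟩

theorem isPreconnected_julia_iff (Γ : Omega) :
    IsPreconnected (julia (generated Γ)) ↔ IsPreconnected (planarJulia Γ) := by
  rw [← coe_image_planarJulia]
  exact OnePoint.isOpenEmbedding_coe.isInducing.isPreconnected_image

/-- Disconnectedness of the Julia set persists near hyperbolic families. -/
theorem eventually_mem_setD {Γ : Omega} (hΓ : Γ ∈ setH) (hD : Γ ∈ setD) :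
    ∀ᶠ Γ' : Omega in 𝓝 Γ, Γ' ∈ setD := by
  have hD' : ¬ IsPreconnected (planarJulia Γ) := fun h => hD ((isPreconnected_julia_iff Γ).2 h)
  have hJ := isCompact_planarJulia Γ
  rw [isPreconnected_iff_subset_of_disjoint_closed] at hD'
  push Not at hD'
  obtain ⟨u, v, hu, hv, huv, hdis, hnu, hnv⟩ := hD'
  obtain ⟨a, haJ, hau⟩ := Set.not_subset.1 hnv
  obtain ⟨b, hbJ, hbv⟩ := Set.not_subset.1 hnu
  have hau' : a ∈ u := (huv haJ).resolve_right hau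
  have hbv' : b ∈ v := (huv hbJ).resolve_left hbv
  have hdisj : Disjoint (planarJulia Γ ∩ u) (planarJulia Γ ∩ v) :=
    Set.disjoint_left.2 fun z hz hz' => by
      have : z ∈ planarJulia Γ ∩ (u ∩ v) := ⟨hz.1, hz.2, hz'.2⟩
      rw [hdis] at this
      exact this
  obtain ⟨δ, hδ, hth⟩ := hdisj.exists_thickenings (hJ.inter_right hu) (hJ.inter_right hv).isClosed
  filter_upwards [eventually_hyperbolic hΓ hδ, eventually_planarJulia_subset_thickening hΓ hδ]
    with Γ' h1 h2
  intro hpre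
  rw [isPreconnected_julia_iff] at hpre
  have hcov : planarJulia Γ' ⊆
      thickening δ (planarJulia Γ ∩ u) ∪ thickening δ (planarJulia Γ ∩ v) := by
    rw [← thickening_union, ← Set.inter_union_distrib_left, Set.inter_eq_left.2 huv]
    exact h1.2.2
  obtain ⟨a', ha', haa'⟩ := mem_thickening_iff.1 (h2 haJ)
  obtain ⟨b', hb', hbb'⟩ := mem_thickening_iff.1 (h2 hbJ)
  have ha1 : a' ∈ thickening δ (planarJulia Γ ∩ u) :=
    mem_thickening_iff.2 ⟨a, ⟨haJ, hau'⟩, by rwa [dist_comm]⟩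
  have hb1 : b' ∈ thickening δ (planarJulia Γ ∩ v) :=
    mem_thickening_iff.2 ⟨b, ⟨hbJ, hbv'⟩, by rwa [dist_comm]⟩
  rcases hpre.subset_or_subset isOpen_thickening isOpen_thickening hth hcov with h | h
  · exact Set.disjoint_left.1 hth (h hb') hb1
  · exact Set.disjoint_left.1 hth ha1 (h ha')

/-- The planar Julia set as a point of the space of nonempty compact subsets of the plane. -/
def juliaCompacts (Γ : Omega) : TopologicalSpace.NonemptyCompacts ℂ :=
  ⟨⟨planarJulia Γ, isCompact_planarJulia Γ⟩, planarJulia_nonempty Γ⟩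

theorem continuousAt_juliaCompacts {Γ : Omega} (hΓ : Γ ∈ setH) : ContinuousAt juliaCompacts Γ := by
  rw [ContinuousAt, Metric.tendsto_nhds]
  intro ε hε
  filter_upwards [eventually_hyperbolic hΓ (half_pos hε),
    eventually_planarJulia_subset_thickening hΓ (half_pos hε)] with Γ' h1 h2
  have h3 : hausdorffDist (planarJulia Γ') (planarJulia Γ) ≤ ε / 2 := by
    refine hausdorffDist_le_of_mem_dist (half_pos hε).le (fun x hx => ?_) fun x hx => ?_
    · obtain ⟨y, hy, hxy⟩ := mem_thickening_iff.1 (h1.2.2 hx)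
      exact ⟨y, hy, hxy.le⟩
    · obtain ⟨y, hy, hxy⟩ := mem_thickening_iff.1 (h2 hx)
      exact ⟨y, hy, hxy.le⟩
  exact lt_of_le_of_lt h3 (half_lt_self hε)

end PolySemigroup
end

theorem lemma5p3 :
    IsOpen PolySemigroup.setH ∧
    IsOpen (PolySemigroup.setH ∩ PolySemigroup.setB) ∧
    IsOpen (PolySemigroup.setH ∩ PolySemigroup.setD) ∧
    IsOpen (PolySemigroup.setH ∩ PolySemigroup.setB ∩ PolySemigroup.setD) ∧
    ∃ J : PolySemigroup.setH → TopologicalSpace.NonemptyCompacts ℂ,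
      (∀ Γ : PolySemigroup.setH,
        (fun z : ℂ => (z : OnePoint ℂ)) '' (J Γ : Set ℂ) =
          PolySemigroup.julia (PolySemigroup.generated Γ.1)) ∧
      Continuous J := by
  refine ⟨isOpen_iff_mem_nhds.2 fun Γ hΓ => ?_, isOpen_iff_mem_nhds.2 fun Γ hΓ => ?_,
    isOpen_iff_mem_nhds.2 fun Γ hΓ => ?_, isOpen_iff_mem_nhds.2 fun Γ hΓ => ?_,
    fun Γ => PolySemigroup.juliaCompacts Γ.1, fun Γ => PolySemigroup.coe_image_planarJulia Γ.1,
    continuous_iff_continuousAt.2 fun Γ =>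
      (PolySemigroup.continuousAt_juliaCompacts Γ.2).comp continuous_subtype_val.continuousAt⟩
  · filter_upwards [PolySemigroup.eventually_hyperbolic hΓ one_pos] with Γ' h using h.1
  · filter_upwards [PolySemigroup.eventually_hyperbolic hΓ.1 one_pos] with Γ' h
      using ⟨h.1, h.2.1 hΓ.2⟩
  · filter_upwards [PolySemigroup.eventually_hyperbolic hΓ.1 one_pos,
      PolySemigroup.eventually_mem_setD hΓ.1 hΓ.2] with Γ' h h' using ⟨h.1, h'⟩
  · filter_upwards [PolySemigroup.eventually_hyperbolic hΓ.1.1 one_pos,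
      PolySemigroup.eventually_mem_setD hΓ.1.1 hΓ.2] with Γ' h h'
      using ⟨⟨h.1, h.2.1 hΓ.1.2⟩, h'⟩
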